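/- **Trichotomy of adjoints.** A *tensor-triangulated category* is a triangulated category with a closed symmetric monoidal structure $(\otimes,\mathbb 1,\hom)$ that is compatible with the triangulation in the sense of Hovey–Palmieri–Strickland: there are natural isomorphisms $\Sigma x\otimes y\cong\Sigma(x\otimes y)$ compatible with the unit and associativity constraints, $\otimes$ and $\hom$ are exact in each variable, and the symmetry of $\Sigma\mathbb 1\otimes\Sigma\mathbb 1$ is $-1$. An object $t$ is *compact* if $\mathrm{Hom}(t,-)$ sends coproducts to coproducts of abelian groups, and $x$ is *rigid* if the natural map $\hom(x,\mathbb 1)\otimes y\to\hom(x,y)$ is an isomorphism for all $y$. A tensor-triangulated category $\mathcal C$ is *rigidly-compactly generated* if it has all small coproducts, there is a set $\mathcal G$ of compact objects such that any $t\in\mathcal C$ with $\mathrm{Hom}(g,t)=0$ for all $g\in\mathcal G$ is zero, and the compact objects of $\mathcal C$ are exactly its rigid objects. Let $\mathcal C$ and $\mathcal D$ be rigidly-compactly generated tensor-triangulated categories and let $f^*:\mathcal D\to\mathcal C$ be a strong symmetric monoidal triangulated functor that preserves all small coproducts. Then exactly one of the following three possibilities holds: 1. There are functors $f_*:\mathcal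 C\to\mathcal D$ and $f^{(1)}:\mathcal D\to\mathcal C$ with adjunctions $f^*\dashv f_*\dashv f^{(1)}$, and no more: $f^*$ has no left adjoint and $f^{(1)}$ has no right adjoint. 2. There are functors $f_{(1)},f_*,f_{(-1)}:\mathcal C\to\mathcal D$ and $f^{(1)}:\mathcal D\to\mathcal C$ with adjunctions $f_{(1)}\dashv f^*\dashv f_*\dashv f^{(1)}\dashv f_{(-1)}$, and no more: $f_{(1)}$ has no left adjoint and $f_{(-1)}$ has no right adjoint. 3. There is a tower of adjunctions that is infinite in both directions: there are functors $f^{(n)}:\mathcal D\to\mathcal C$ and $f_{(n)}:\mathcal C\to\mathcal D$ for all $n\in\mathbb Z$, with $f^{(0)}=f^*$, such that $f^{(n)}\dashv f_{(-n)}\dashv f^{(n+1)}$ for all $n\in\mathbb Z$ (so $f_*=f_{(0)}$). -/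

import Mathlib

universe v u u₁ u₂

open CategoryTheory Category Limits MonoidalCategory Opposite Pretriangulated

namespace TTAdjoints

section Categories

variable (C : Type u) [Category.{v} C] [HasZeroObject C] [Preadditive C] [HasShift C ℤ]
  [∀ n : ℤ, (shiftFunctor C n).Additive] [Pretriangulated C]

/-- Compatibility of a closed symmetric monoidal structure with a triangulation, in the sense of
Hovey-Palmieri-Strickland, Appendix A.2. The internal hom `ihom W` is automatically exact in its
second variable, being right adjoint to an exact functor, so this is not listed. -/
class TensorTriangulated [MonoidalCategory C] [SymmetricCategory C] [MonoidalClosed C] where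
  /-- the tensor product preserves suspensions: `ΣX ⊗ Y ≅ Σ(X ⊗ Y)` -/
  suspIso (X Y : C) : X⟦(1 : ℤ)⟧ ⊗ Y ≅ (X ⊗ Y)⟦(1 : ℤ)⟧
  suspIso_natural {X X' Y Y' : C} (f : X ⟶ X') (g : Y ⟶ Y') :
    (f⟦(1 : ℤ)⟧' ⊗ₘ g) ≫ (suspIso X' Y').hom = (suspIso X Y).hom ≫ (f ⊗ₘ g)⟦(1 : ℤ)⟧'
  suspIso_unit (X : C) :
    (suspIso X (𝟙_ C)).hom ≫ (ρ_ X).hom⟦(1 : ℤ)⟧' = (ρ_ (X⟦(1 : ℤ)⟧)).hom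
  suspIso_assoc (X Y Z : C) :
    (suspIso X Y).hom ▷ Z ≫ (suspIso (X ⊗ Y) Z).hom ≫ (α_ X Y Z).hom⟦(1 : ℤ)⟧' =
      (α_ (X⟦(1 : ℤ)⟧) Y Z).hom ≫ (suspIso X (Y ⊗ Z)).hom
  /-- the tensor product is exact (in each variable, by symmetry) -/
  tensor_exact (W : C) (T : Triangle C) (hT : T ∈ distTriang C) :
    Triangle.mk (T.mor₁ ▷ W) (T.mor₂ ▷ W) (T.mor₃ ▷ W ≫ (suspIso T.obj₁ W).hom) ∈ distTriang C
  /-- the internal hom is exact as a contravariant functor of its first variable -/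
  ihom_exact (W : C) : open scoped Pretriangulated.Opposite in
    ∃ _ : ((MonoidalClosed.internalHom (C := C)).flip.obj W).CommShift ℤ,
      ((MonoidalClosed.internalHom (C := C)).flip.obj W).IsTriangulated
  /-- graded commutativity: the symmetry of `S¹ ⊗ S¹`, where `S¹ = Σ𝟙`, is `-1`; by coherence, the
  symmetry `Sʳ ⊗ Sˢ ≅ Sˢ ⊗ Sʳ` is then `(-1)^(rs)` for all integers `r` and `s` -/
  braiding_circle :
    (β_ ((𝟙_ C)⟦(1 : ℤ)⟧) ((𝟙_ C)⟦(1 : ℤ)⟧)).hom = -𝟙 ((𝟙_ C)⟦(1 : ℤ)⟧ ⊗ (𝟙_ C)⟦(1 : ℤ)⟧)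

end Categories

/-- `t` is compact if `Hom(t, -) : C ⥤ Ab` preserves (small) coproducts. -/
def IsCompactObj {C : Type u} [Category.{v} C] [Preadditive C] (t : C) : Prop :=
  ∀ J : Type v, PreservesColimitsOfShape (Discrete J) (preadditiveCoyoneda.obj (op t))

/-- The canonical map `hom(x, 𝟙) ⊗ y ⟶ hom(x, y)`, adjoint to
`x ⊗ (hom(x, 𝟙) ⊗ y) ≅ (x ⊗ hom(x, 𝟙)) ⊗ y ⟶ 𝟙 ⊗ y ≅ y`. -/
def dualTensorHom {C : Type u} [Category.{v} C] [MonoidalCategory C] [MonoidalClosed C] (x y : C) :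
    (ihom x).obj (𝟙_ C) ⊗ y ⟶ (ihom x).obj y :=
  MonoidalClosed.curry
    ((α_ x ((ihom x).obj (𝟙_ C)) y).inv ≫ (ihom.ev x).app (𝟙_ C) ▷ y ≫ (λ_ y).hom)

/-- `x` is rigid (strongly dualizable) if `hom(x, 𝟙) ⊗ y ⟶ hom(x, y)` is invertible for all `y`. -/
def IsRigidObj {C : Type u} [Category.{v} C] [MonoidalCategory C] [MonoidalClosed C] (x : C) :
    Prop :=
  ∀ y : C, IsIso (dualTensorHom x y)

/-- `C` has small coproducts, and a set of compact objects that detects zero objects. -/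
def IsCompactlyGenerated (C : Type u) [Category.{v} C] [Preadditive C] : Prop :=
  HasCoproducts.{v} C ∧ ∃ (I : Type v) (G : I → C), (∀ i, IsCompactObj (G i)) ∧
    ∀ t : C, (∀ (i : I) (f : G i ⟶ t), f = 0) → IsZero t

/-- `C` is compactly generated, and its compact objects are exactly its rigid objects. -/
def IsRigidlyCompactlyGenerated (C : Type u) [Category.{v} C] [Preadditive C]
    [MonoidalCategory C] [MonoidalClosed C] : Prop :=
  IsCompactlyGenerated C ∧ ∀ x : C, IsCompactObj x ↔ IsRigidObj x

section Adjoints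

variable {C : Type u₁} [Category.{v} C] {D : Type u₂} [Category.{v} D]

/-- `f ⊣ f_* ⊣ f^(1)`, and neither end of this chain has a further adjoint. -/
def ExactlyThree (f : D ⥤ C) : Prop :=
  ∃ (fDown : C ⥤ D) (fUp₁ : D ⥤ C),
    Nonempty (f ⊣ fDown) ∧ Nonempty (fDown ⊣ fUp₁) ∧
    ¬ f.IsRightAdjoint ∧ ¬ fUp₁.IsLeftAdjoint

/-- `f_(1) ⊣ f ⊣ f_* ⊣ f^(1) ⊣ f_(-1)`, and neither end of this chain has a further adjoint. -/
def ExactlyFive (f : D ⥤ C) : Prop :=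
  ∃ (fDown₁ fDown fDownNeg₁ : C ⥤ D) (fUp₁ : D ⥤ C),
    Nonempty (fDown₁ ⊣ f) ∧ Nonempty (f ⊣ fDown) ∧ Nonempty (fDown ⊣ fUp₁) ∧
    Nonempty (fUp₁ ⊣ fDownNeg₁) ∧ ¬ fDown₁.IsRightAdjoint ∧ ¬ fDownNeg₁.IsLeftAdjoint

/-- A doubly infinite tower of adjoints `⋯ ⊣ f^(n) ⊣ f_(-n) ⊣ f^(n+1) ⊣ ⋯` with `f^(0) = f`. -/
def InfiniteTower (f : D ⥤ C) : Prop :=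
  ∃ (fUp : ℤ → (D ⥤ C)) (fDown : ℤ → (C ⥤ D)), fUp 0 = f ∧
    ∀ n : ℤ, Nonempty (fUp n ⊣ fDown (-n)) ∧ Nonempty (fDown (-n) ⊣ fUp (n + 1))

end Adjoints

end TTAdjoints

/-! Write `f_(1) ⊣ f ⊣ f_* ⊣ f^(1) ⊣ f_(-1)` for the adjoints that exist. A monoidal functor
preserves rigid, hence compact, objects. Brown representability
(`IsCompactlyGenerated.isLeftAdjoint`) gives `f_*`, and preservation of compacts by `f` makes `f_*`
preserve coproducts, so `f^(1)` exists too.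

A left adjoint of `f` exists iff `f^(1)` has a right adjoint, because each is equivalent to `f_*`
preserving compacts (`isRightAdjoint_iff_isLeftAdjoint`). In one direction, `dual (f_(1) w) ≅ f_*
(dual w)`; in the other, `dual (f_* (dual z))` is the value of the left adjoint at a compact `z`. So
three adjoints force five.

Let `ω = f^(1) 𝟙`. One more adjoint at either end forces `ω` to be rigid
(`isRigidObj_of_isRightAdjoint`, `isRigidObj_of_isLeftAdjoint`). The projection formula gives `f^(1)
≅ ω ⊗ f` (`nonempty_iso_comp_tensorLeft`); comparing left adjoints gives `f_* ≅ f_(1) ∘ hom(ω, -)`,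
and duality then gives `hom(ω, ω) ≅ 𝟙` (`nonempty_unit_iso`). A rigid object with this property is
invertible, and twisting by its powers gives the infinite tower. The three cases exclude each other
by uniqueness of adjoints. -/

namespace TTAdjoints

/-! ### Compactness as factorization through finite subcoproducts. -/

section Compact

variable {C : Type u} [Category.{v} C] [Preadditive C]

lemma sigma_eq_sum_of_eq_sum {J : Type v} [DecidableEq J] {X : J → C} [HasCoproduct X] {t : C}
    (s : Finset J) (β : ∀ j, t ⟶ X j) (k : J) :
    (∑ j ∈ s, β j ≫ Sigma.ι X j) ≫ Sigma.π X k = if k ∈ s then β k else 0 := by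
  rw [Preadditive.sum_comp]
  split_ifs with hk
  · rw [Finset.sum_eq_single k]
    · simp
    · intro j _ hj
      rw [assoc, Sigma.ι_π_of_ne _ hj, comp_zero]
    · exact fun h => (h hk).elim
  · refine Finset.sum_eq_zero fun j hj => ?_
    rw [assoc, Sigma.ι_π_of_ne _ (by rintro rfl; exact hk hj), comp_zero]

/-- The maps factoring through a summand generate a subgroup `S` of `Hom(t, Y)`. The quotient map by
`S` vanishes on each summand of the coproduct `Hom(t, Y)` in abelian groups, so it is zero. -/
lemma IsCompactObj.exists_eq_sum_of_isColimit {t : C} (ht : IsCompactObj t) {J : Type v}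
    {X : J → C} {Y : C} (i : ∀ j, X j ⟶ Y) (hc : IsColimit (Cofan.mk Y i)) (a : t ⟶ Y) :
    ∃ (s : Finset J) (β : ∀ j, t ⟶ X j), a = ∑ j ∈ s, β j ≫ i j := by
  classical
  have := ht J
  let G := preadditiveCoyoneda.obj (op t)
  have hc' := isColimitCofanMkObjOfIsColimit G X i hc
  let S : AddSubgroup (t ⟶ Y) := AddSubgroup.closure { b | ∃ (j : J) (β : t ⟶ X j), b = β ≫ i j }
  have hS : a ∈ S := by
    let p : G.obj Y ⟶ AddCommGrpCat.of ((t ⟶ Y) ⧸ S) := AddCommGrpCat.ofHom (QuotientAddGroup.mk' S)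
    have hp : p = 0 := by
      refine Cofan.IsColimit.hom_ext hc' _ _ fun j => ?_
      ext β
      exact (QuotientAddGroup.eq_zero_iff _).2 (AddSubgroup.subset_closure ⟨j, β, rfl⟩)
    have h := congr($(hp) a)
    exact (QuotientAddGroup.eq_zero_iff a).1 h
  induction hS using AddSubgroup.closure_induction with
  | mem b hb =>
    obtain ⟨j, β, rfl⟩ := hb
    exact ⟨{j}, Function.update 0 j β, by simp⟩
  | zero => exact ⟨∅, 0, by simp⟩
  | add x y _ _ hx hy =>
    obtain ⟨s, β, rfl⟩ := hx
    obtain ⟨s', β', rfl⟩ := hy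
    refine ⟨s ∪ s', fun j => (if j ∈ s then β j else 0) + (if j ∈ s' then β' j else 0), ?_⟩
    simp only [Preadditive.add_comp, Finset.sum_add_distrib]
    congr 1
    · rw [← Finset.sum_subset Finset.subset_union_left
        (fun j _ hj => by rw [if_neg hj, zero_comp])]
      exact Finset.sum_congr rfl fun j hj => by rw [if_pos hj]
    · rw [← Finset.sum_subset Finset.subset_union_right
        (fun j _ hj => by rw [if_neg hj, zero_comp])]
      exact Finset.sum_congr rfl fun j hj => by rw [if_pos hj]
  | neg x _ hx =>
    obtain ⟨s, β, rfl⟩ := hx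
    exact ⟨s, fun j => - β j, by simp⟩

lemma IsCompactObj.exists_eq_sum {t : C} (ht : IsCompactObj t) {J : Type v}
    {X : J → C} [HasCoproduct X] (a : t ⟶ ∐ X) :
    ∃ (s : Finset J) (β : ∀ j, t ⟶ X j), a = ∑ j ∈ s, β j ≫ Sigma.ι X j :=
  ht.exists_eq_sum_of_isColimit _ (coproductIsCoproduct X) a

/-- Only existence of a finite decomposition is needed: its terms are recovered by the projections
`Sigma.π`, which exist thanks to zero morphisms. Maps out of `Hom(t, ∐ X)` are then finite sums over
components. -/
lemma isCompactObj_of_exists_eq_sum [HasCoproducts.{v} C] {t : C}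
    (h : ∀ (J : Type v) (X : J → C) (a : t ⟶ ∐ X),
      ∃ (s : Finset J) (β : ∀ j, t ⟶ X j), a = ∑ j ∈ s, β j ≫ Sigma.ι X j) :
    IsCompactObj t := by
  classical
  intro J
  refine @preservesColimitsOfShape_of_discrete _ _ _ _ _ _ fun X => ?_
  let G := preadditiveCoyoneda.obj (op t)
  have hfin : ∀ a : t ⟶ ∐ X, ∃ s : Finset J, (∀ j, a ≫ Sigma.π X j ≠ 0 → j ∈ s) ∧
      a = ∑ j ∈ s, (a ≫ Sigma.π X j) ≫ Sigma.ι X j := fun a => by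
    obtain ⟨s, β, rfl⟩ := h J X a
    refine ⟨s, fun j hj => ?_, ?_⟩
    · by_contra hs
      rw [sigma_eq_sum_of_eq_sum, if_neg hs] at hj
      exact hj rfl
    · exact Finset.sum_congr rfl fun j hj => by rw [sigma_eq_sum_of_eq_sum, if_pos hj]
  refine preservesColimit_of_preserves_colimit_cocone (coproductIsCoproduct X)
    ((isColimitMapCoconeCofanMkEquiv G X (Sigma.ι X)).symm ?_)
  have hsupp : ∀ (A : AddCommGrpCat.{v}) (k : ∀ j, (t ⟶ X j) →+ A) (a : t ⟶ ∐ X),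
      (Function.support fun j => k j (a ≫ Sigma.π X j)).Finite := fun A k a => by
    obtain ⟨s, hs, -⟩ := hfin a
    refine s.finite_toSet.subset fun j hj => hs j ?_
    rintro h0
    exact hj (by simp only [h0]; exact map_zero (k j))
  let κ (c : Cofan fun j => G.obj (X j)) (j : J) : (t ⟶ X j) →+ c.pt := (c.inj j).hom
  let φ (c : Cofan fun j => G.obj (X j)) : (t ⟶ ∐ X) →+ c.pt :=
    { toFun := fun a => ∑ᶠ j, κ c j (a ≫ Sigma.π X j)
      map_zero' := by simp
      map_add' := fun a b => by
        rw [← finsum_add_distrib (hsupp _ (κ c) a) (hsupp _ (κ c) b)]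
        simp }
  have hφ₁ (c : Cofan fun j => G.obj (X j)) (j : J) (β : t ⟶ X j) :
      φ c (β ≫ Sigma.ι X j) = κ c j β := by
    change ∑ᶠ k, κ c k ((β ≫ Sigma.ι X j) ≫ Sigma.π X k) = κ c j β
    rw [finsum_eq_single _ j]
    · simp
    · intro k hk
      rw [assoc, Sigma.ι_π_of_ne _ hk.symm, comp_zero, map_zero]
  refine Cofan.IsColimit.mk _ (fun c => AddCommGrpCat.ofHom (φ c)) ?_ ?_
  · intro c j
    ext β
    exact hφ₁ c j β
  · intro c m hm
    ext a
    let μ : (t ⟶ ∐ X) →+ c.pt := m.hom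
    change μ a = φ c a
    obtain ⟨s, -, has⟩ := hfin a
    rw [has, map_sum, map_sum]
    refine Finset.sum_congr rfl fun j _ => ?_
    rw [hφ₁]
    exact congr($(hm j) (a ≫ Sigma.π X j))

lemma IsCompactObj.of_iso [HasCoproducts.{v} C] {t t' : C} (ht : IsCompactObj t) (e : t ≅ t') :
    IsCompactObj t' := by
  refine isCompactObj_of_exists_eq_sum fun J X a => ?_
  obtain ⟨s, β, h⟩ := ht.exists_eq_sum (e.hom ≫ a)
  refine ⟨s, fun j => e.inv ≫ β j, ?_⟩
  simpa [Preadditive.comp_sum] using e.inv ≫= h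

end Compact

/-! ### Compact objects under left adjoints, and exactness in triangulated categories. -/

section Adjunction

variable {C : Type u₁} [Category.{v} C] [Preadditive C] {D : Type u₂} [Category.{v} D]
  [Preadditive D]

lemma IsCompactObj.of_adjunction [HasCoproducts.{v} C] {L : D ⥤ C} {R : C ⥤ D} (adj : L ⊣ R)
    [L.Additive] (hR : ∀ J : Type v, PreservesColimitsOfShape (Discrete J) R) {t : D}
    (ht : IsCompactObj t) : IsCompactObj (L.obj t) := by
  refine isCompactObj_of_exists_eq_sum fun J X a => ?_
  have := hR J
  obtain ⟨s, β, h⟩ := ht.exists_eq_sum_of_isColimit _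
    (isColimitCofanMkObjOfIsColimit R X _ (coproductIsCoproduct X)) (adj.homEquiv _ _ a)
  refine ⟨s, fun j => (adj.homEquiv _ _).symm (β j), ?_⟩
  apply (adj.homEquiv _ _).injective
  have hsum := map_sum (adj.homAddEquiv t (∐ X))
    (fun j => (adj.homEquiv _ _).symm (β j) ≫ Sigma.ι X j) s
  refine h.trans (Eq.trans (Finset.sum_congr rfl fun j _ => ?_) hsum.symm)
  change _ = adj.homEquiv _ _ ((adj.homEquiv _ _).symm (β j) ≫ Sigma.ι X j)
  rw [Adjunction.homEquiv_naturality_right, Equiv.apply_symm_apply]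

end Adjunction

lemma IsCompactObj.shift {C : Type u} [Category.{v} C] [Preadditive C] [HasShift C ℤ]
    [∀ n : ℤ, (shiftFunctor C n).Additive] [HasCoproducts.{v} C] {t : C} (ht : IsCompactObj t) (n : ℤ) :
    IsCompactObj (t⟦n⟧) :=
  have : (shiftEquiv C n).functor.Additive := inferInstanceAs (shiftFunctor C n).Additive
  IsCompactObj.of_adjunction (shiftEquiv C n).toAdjunction
    (fun J => inferInstanceAs (PreservesColimitsOfShape (Discrete J) (shiftFunctor C (-n)))) ht

lemma IsCompactlyGenerated.isZero {C : Type u} [Category.{v} C] [Preadditive C]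
    (hC : IsCompactlyGenerated C) {x : C}
    (hx : ∀ (g : C) (_ : IsCompactObj g) (a : g ⟶ x), a = 0) : IsZero x := by
  obtain ⟨-, I, G, hG, h⟩ := hC
  exact h x fun i a => hx _ (hG i) a

section Triangulated

variable {C : Type u} [Category.{v} C] [HasZeroObject C] [Preadditive C] [HasShift C ℤ]
  [∀ n : ℤ, (shiftFunctor C n).Additive] [Pretriangulated C]

section Exactness

variable {x y z : C} {u : x ⟶ y} {p : y ⟶ z} {q : z ⟶ x⟦(1 : ℤ)⟧}
  (hT : Triangle.mk u p q ∈ distTriang C)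
include hT

lemma distTriang_comp₁₂ : u ≫ p = 0 := comp_distTriang_mor_zero₁₂ _ hT

lemma distTriang_comp₃₁ : q ≫ u⟦(1 : ℤ)⟧' = 0 := comp_distTriang_mor_zero₃₁ _ hT

lemma distTriang_lift₃ {g : C} (a : g ⟶ z) (h : a ≫ q = 0) : ∃ b : g ⟶ y, a = b ≫ p :=
  Triangle.coyoneda_exact₃ _ hT a h

end Exactness

/-- The part of the long exact sequence around `Hom(g, z)`: injectivity on the desuspension makes `a
≫ q` vanish, and surjectivity then kills the lift of `a` to `y`. -/
lemma distTriang_hom_eq_zero {x y z : C} {u : x ⟶ y} {p : y ⟶ z} {q : z ⟶ x⟦(1 : ℤ)⟧}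
    (hT : Triangle.mk u p q ∈ distTriang C) {g : C}
    (h : Function.Surjective fun a : g ⟶ x => a ≫ u)
    (h' : Function.Injective fun a : g⟦(-1 : ℤ)⟧ ⟶ x => a ≫ u) (a : g ⟶ z) : a = 0 := by
  have hq : a ≫ q = 0 := by
    let e : (g⟦(-1 : ℤ)⟧)⟦(1 : ℤ)⟧ ≅ g := (shiftFunctorCompIsoId C (-1 : ℤ) 1 (by simp)).app g
    obtain ⟨b, hb⟩ := (shiftFunctor C (1 : ℤ)).map_surjective (e.hom ≫ a ≫ q)
    have h2 : b ≫ u = 0 := by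
      apply (shiftFunctor C (1 : ℤ)).map_injective
      rw [Functor.map_comp, hb, assoc, assoc, distTriang_comp₃₁ hT, comp_zero, comp_zero,
        Functor.map_zero]
    have h3 : b = 0 := h' (by simpa only [zero_comp] using h2)
    rw [h3, Functor.map_zero] at hb
    rw [← cancel_epi e.hom, ← hb, comp_zero]
  obtain ⟨b, rfl⟩ := distTriang_lift₃ hT a hq
  obtain ⟨c, rfl⟩ := h b
  dsimp only
  rw [assoc, distTriang_comp₁₂ hT, comp_zero]

lemma IsCompactlyGenerated.isIso (hC : IsCompactlyGenerated C) {x y : C} (u : x ⟶ y)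
    (hu : ∀ g : C, IsCompactObj g → Function.Bijective fun a : g ⟶ x => a ≫ u) : IsIso u := by
  have := hC.1
  obtain ⟨z, p, q, hT⟩ := distinguished_cocone_triangle u
  exact (Triangle.isZero₃_iff_isIso₁ _ hT).1 (hC.isZero fun g hg =>
    distTriang_hom_eq_zero hT (hu g hg).2 (hu _ (hg.shift _)).1)

end Triangulated

section Adjunction

variable {C : Type u₁} [Category.{v} C] [Preadditive C]
  {D : Type u₂} [Category.{v} D] [HasZeroObject D] [Preadditive D] [HasShift D ℤ]
  [∀ n : ℤ, (shiftFunctor D n).Additive] [Pretriangulated D]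

/-- The comparison `∐ R X ⟶ R (∐ X)` is tested on `Hom(g, -)` for `g` compact. Injectivity follows
from the projections alone; surjectivity uses that `L g` is compact. -/
lemma preservesCoproducts_of_preserves_compact (hC : IsCompactlyGenerated C)
    (hD : IsCompactlyGenerated D) {L : D ⥤ C} {R : C ⥤ D} (adj : L ⊣ R) [R.Additive]
    (hL : ∀ t : D, IsCompactObj t → IsCompactObj (L.obj t)) (J : Type v) :
    PreservesColimitsOfShape (Discrete J) R := by
  classical
  have := hC.1
  have := hD.1
  refine @preservesColimitsOfShape_of_discrete _ _ _ _ _ _ fun X => ?_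
  have : IsIso (sigmaComparison R X) := by
    refine hD.isIso _ fun g hg => ⟨?_, fun a => ?_⟩
    · refine (injective_iff_map_eq_zero
        (((preadditiveCoyoneda.obj (op g)).map (sigmaComparison R X)).hom)).2 ?_
      intro a ha
      obtain ⟨s, β, rfl⟩ := hg.exists_eq_sum a
      replace ha : (∑ j ∈ s, β j ≫ Sigma.ι (fun j => R.obj (X j)) j) ≫ sigmaComparison R X = 0 := ha
      refine Finset.sum_eq_zero fun k hk => ?_
      have h1 := congr($ha ≫ R.map (Sigma.π X k))
      rw [zero_comp, Preadditive.sum_comp, Preadditive.sum_comp, Finset.sum_eq_single k] at h1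
      · rw [assoc, assoc, ι_comp_sigmaComparison_assoc, ← R.map_comp, Sigma.ι_π_eq_id, R.map_id,
          comp_id] at h1
        rw [h1, zero_comp]
        rfl
      · intro j _ hj
        rw [assoc, assoc, ι_comp_sigmaComparison_assoc, ← R.map_comp, Sigma.ι_π_of_ne _ hj,
          R.map_zero, comp_zero]
      · exact fun h => (h hk).elim
    · obtain ⟨s, β, h⟩ := (hL g hg).exists_eq_sum ((adj.homEquiv _ _).symm a)
      refine ⟨∑ j ∈ s, adj.homEquiv _ _ (β j) ≫ Sigma.ι (fun j => R.obj (X j)) j, ?_⟩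
      dsimp only
      rw [Equiv.symm_apply_eq] at h
      rw [h, Adjunction.homEquiv_unit, R.map_sum, Preadditive.comp_sum, Preadditive.sum_comp]
      refine Finset.sum_congr rfl fun j _ => ?_
      rw [assoc, ι_comp_sigmaComparison, Adjunction.homEquiv_unit, R.map_comp, assoc]
  exact PreservesCoproduct.of_iso_comparison R X

end Adjunction

section Coproducts

variable {C : Type u₁} [Category.{v} C] [HasCoproducts.{v} C] {D : Type u₂} [Category.{v} D]
  (F : C ⥤ D) (hF : ∀ J : Type v, PreservesColimitsOfShape (Discrete J) F)
include hF

lemma map_sigma_hom_ext {J : Type v} {X : J → C} {d : D} {a b : F.obj (∐ X) ⟶ d}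
    (h : ∀ j, F.map (Sigma.ι X j) ≫ a = F.map (Sigma.ι X j) ≫ b) : a = b := by
  have := hF J
  exact Cofan.IsColimit.hom_ext (isColimitCofanMkObjOfIsColimit F X _ (coproductIsCoproduct X)) _ _ h

lemma exists_map_sigma_desc {J : Type v} {X : J → C} {d : D} (k : ∀ j, F.obj (X j) ⟶ d) :
    ∃ a : F.obj (∐ X) ⟶ d, ∀ j, F.map (Sigma.ι X j) ≫ a = k j := by
  have := hF J
  let hc := isColimitCofanMkObjOfIsColimit F X _ (coproductIsCoproduct X)
  exact ⟨Cofan.IsColimit.desc hc k, fun j => Cofan.IsColimit.fac hc k j⟩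

end Coproducts

lemma exists_eq_comp_of_le {C : Type u} [Category.{v} C] {X : ℕ → C} (t : ∀ n, X n ⟶ X (n + 1))
    {Y : C} (j : ∀ n, X n ⟶ Y)
    (hj : ∀ n, t n ≫ j (n + 1) = j n) {g : C} {n N : ℕ} (hn : n ≤ N) (b : g ⟶ X n) :
    ∃ b' : g ⟶ X N, b ≫ j n = b' ≫ j N := by
  induction N, hn using Nat.le_induction with
  | base => exact ⟨b, rfl⟩
  | succ N _ ih =>
    obtain ⟨b', h⟩ := ih
    exact ⟨b' ≫ t N, by rw [h, assoc, hj]⟩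

/-! ### Homotopy colimits and approximation by generators. -/

section Brown

variable {C : Type u₁} [Category.{v} C] [HasZeroObject C] [Preadditive C] [HasShift C ℤ]
  [∀ n : ℤ, (shiftFunctor C n).Additive] [Pretriangulated C]
  {D : Type u₂} [Category.{v} D] [HasZeroObject D] [Preadditive D] [HasShift D ℤ]
  [∀ n : ℤ, (shiftFunctor D n).Additive] [Pretriangulated D]

lemma map_distTriang_desc₂ (F : C ⥤ D) [F.CommShift ℤ] [F.IsTriangulated]
    {x y z : C} {u : x ⟶ y} {p : y ⟶ z} {q : z ⟶ x⟦(1 : ℤ)⟧}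
    (hT : Triangle.mk u p q ∈ distTriang C) {w : D} (a : F.obj y ⟶ w) (h : F.map u ≫ a = 0) :
    ∃ b : F.obj z ⟶ w, a = F.map p ≫ b :=
  Triangle.yoneda_exact₂ _ (F.map_distinguished _ hT) a h

section

variable [HasCoproducts.{v} C] (F : C ⥤ D)
  (hF : ∀ J : Type v, PreservesColimitsOfShape (Discrete J) F) [F.CommShift ℤ] [F.IsTriangulated]

include hF in
/-- A homotopy colimit of a sequence: it is built from coproducts and a cone, every compatible family
of morphisms extends to it, and morphisms from compact objects factor through some stage. -/
lemma exists_homotopyColimit (X : ℕ → C) (t : ∀ n, X n ⟶ X (n + 1)) :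
    ∃ (Y : C) (φ : (∐ fun n : ULift.{v} ℕ => X n.down) ⟶ ∐ fun n : ULift.{v} ℕ => X n.down)
      (p : (∐ fun n : ULift.{v} ℕ => X n.down) ⟶ Y)
      (q : Y ⟶ (∐ fun n : ULift.{v} ℕ => X n.down)⟦(1 : ℤ)⟧) (j : ∀ n, X n ⟶ Y),
      Triangle.mk φ p q ∈ distTriang C ∧ (∀ n, t n ≫ j (n + 1) = j n) ∧
      (∀ (d : D) (k : ∀ n, F.obj (X n) ⟶ d) (_ : ∀ n, F.map (t n) ≫ k (n + 1) = k n),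
        ∃ l : F.obj Y ⟶ d, ∀ n, F.map (j n) ≫ l = k n) ∧
      ∀ (g : C) (_ : IsCompactObj g) (a : g ⟶ Y), ∃ (n : ℕ) (b : g ⟶ X n), a = b ≫ j n := by
  let Z : ULift.{v} ℕ → C := fun n => X n.down
  let i (n : ℕ) : X n ⟶ ∐ Z := Sigma.ι Z ⟨n⟩
  let sh : ∐ Z ⟶ ∐ Z := Sigma.desc fun n : ULift.{v} ℕ => t n.down ≫ i (n.down + 1)
  have hsh (n : ℕ) : i n ≫ sh = t n ≫ i (n + 1) := Sigma.ι_desc _ _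
  let φ : ∐ Z ⟶ ∐ Z := 𝟙 _ - sh
  have hφ (n : ℕ) : i n ≫ φ = i n - t n ≫ i (n + 1) := by
    rw [Preadditive.comp_sub, comp_id, hsh]
  -- If `b = b ≫ sh`, then component `0` of `b` vanishes and component `n + 1` is determined by
  -- component `n`. Compactness of `g` ensures that vanishing components force `b = 0`.
  have hφ_inj (g : C) (hg : IsCompactObj g) (b : g ⟶ ∐ Z) (hb : b ≫ φ = 0) : b = 0 := by
    classical
    obtain ⟨s, β, h⟩ := hg.exists_eq_sum b
    have hb' : b = b ≫ sh := by
      rwa [Preadditive.comp_sub, comp_id, sub_eq_zero] at hb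
    let π (n : ℕ) : ∐ Z ⟶ X n := Sigma.π Z ⟨n⟩
    have hπ_ne (n m : ℕ) (h : n ≠ m) : i n ≫ π m = 0 :=
      Sigma.ι_π_of_ne Z fun h' => h congr(($h').down)
    have hπ_eq (n : ℕ) : i n ≫ π n = 𝟙 _ := Sigma.ι_π_eq_id Z ⟨n⟩
    have hsh0 : sh ≫ π 0 = 0 := by
      refine Sigma.hom_ext _ _ fun ⟨n⟩ => ?_
      change i n ≫ sh ≫ π 0 = i n ≫ 0
      rw [← assoc, hsh, assoc, hπ_ne _ _ (by lia), comp_zero, comp_zero]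
    have hshs (m : ℕ) : sh ≫ π (m + 1) = π m ≫ t m := by
      refine Sigma.hom_ext _ _ fun ⟨n⟩ => ?_
      change i n ≫ sh ≫ π (m + 1) = i n ≫ π m ≫ t m
      rw [← assoc, hsh, assoc, ← assoc (i n)]
      by_cases h : n = m
      · subst h
        rw [hπ_eq, hπ_eq, id_comp, comp_id]
      · rw [hπ_ne _ _ h, hπ_ne _ _ (by lia), comp_zero, zero_comp]
    have h0 (n : ℕ) : b ≫ π n = 0 := by
      induction n with
      | zero => rw [hb', assoc, hsh0, comp_zero]
      | succ n ih => rw [hb', assoc, hshs, ← assoc, ih, zero_comp]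
    rw [h]
    refine Finset.sum_eq_zero fun n hn => ?_
    have h1 : b ≫ π n.down = β n := by
      rw [h]
      exact (sigma_eq_sum_of_eq_sum s β n).trans (if_pos hn)
    rw [← h1, h0, zero_comp]
  obtain ⟨Y, p, q, hT⟩ := distinguished_cocone_triangle φ
  have hj (n : ℕ) : t n ≫ i (n + 1) ≫ p = i n ≫ p := by
    have h := i n ≫= distTriang_comp₁₂ hT
    rw [← assoc, hφ, Preadditive.sub_comp, comp_zero, sub_eq_zero, assoc] at h
    exact h.symm
  refine ⟨Y, φ, p, q, fun n => i n ≫ p, hT, hj, ?_, ?_⟩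
  · intro d k hk
    obtain ⟨l, hl⟩ := exists_map_sigma_desc F hF fun n : ULift.{v} ℕ => k n.down
    replace hl (n : ℕ) : F.map (i n) ≫ l = k n := hl ⟨n⟩
    have h0 : F.map φ ≫ l = 0 := by
      refine map_sigma_hom_ext F hF fun ⟨n⟩ => ?_
      change F.map (i n) ≫ _ = _
      rw [← assoc, ← F.map_comp, hφ, F.map_sub, F.map_comp, Preadditive.sub_comp, assoc, hl, hl, hk,
        sub_self, comp_zero]
    obtain ⟨l', rfl⟩ := map_distTriang_desc₂ F hT l h0
    exact ⟨l', fun n => by rw [F.map_comp, assoc, hl]⟩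
  · intro g hg a
    have hq : a ≫ q = 0 := by
      let e : (g⟦(-1 : ℤ)⟧)⟦(1 : ℤ)⟧ ≅ g := (shiftFunctorCompIsoId C (-1 : ℤ) 1 (by simp)).app g
      obtain ⟨b, hb⟩ := (shiftFunctor C (1 : ℤ)).map_surjective (e.hom ≫ a ≫ q)
      have h2 : b ≫ φ = 0 := by
        apply (shiftFunctor C (1 : ℤ)).map_injective
        rw [Functor.map_comp, hb, assoc, assoc, distTriang_comp₃₁ hT, comp_zero, comp_zero,
          Functor.map_zero]
      rw [hφ_inj _ (hg.shift (-1)) b h2, Functor.map_zero] at hb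
      rw [← cancel_epi e.hom, ← hb, comp_zero]
    obtain ⟨b, rfl⟩ := distTriang_lift₃ hT a hq
    obtain ⟨s, β, rfl⟩ := hg.exists_eq_sum b
    -- The finitely many summands that occur are all pushed forward to one common stage `N`.
    let N := s.sup ULift.down
    choose β' hβ' using fun n : s => exists_eq_comp_of_le t (fun n => i n ≫ p) hj
      (Finset.le_sup (f := ULift.down) n.2 : n.1.down ≤ N) (β n)
    refine ⟨N, ∑ n : s, β' n, ?_⟩
    rw [Preadditive.sum_comp, Preadditive.sum_comp, ← Finset.sum_coe_sort]
    refine Finset.sum_congr rfl fun n _ => ?_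
    rw [assoc]
    exact hβ' n

/-- An object with property `P` over `d`, for a functor `F`. -/
structure Approximation (P : ObjectProperty C) (d : D) where
  /-- the approximating object -/
  obj : C
  prop : P obj
  /-- the structure morphism -/
  hom : F.obj obj ⟶ d

section

variable (P : ObjectProperty C) (hP : ∀ (J : Type v) (X : J → C), (∀ j, P (X j)) → P (∐ X))
  (hP₃ : ∀ {x y z : C} {u : x ⟶ y} {p : y ⟶ z} {q : z ⟶ x⟦(1 : ℤ)⟧},
    Triangle.mk u p q ∈ distTriang C → P x → P y → P z)
  {I : Type v} (G : I → C) (hG : ∀ i, IsCompactObj (G i)) (hPG : ∀ i, P (G i)) {d : D}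

include hF hP hP₃ hPG in
-- Take the cone of the coproduct of all maps from generators to `A.obj` that die over `d`: the
-- structure map extends to the cone, and these maps die in it.
lemma Approximation.exists_next (A : Approximation F P d) :
    ∃ (A' : Approximation F P d) (t : A.obj ⟶ A'.obj), F.map t ≫ A'.hom = A.hom ∧
      ∀ (i : I) (a : G i ⟶ A.obj), F.map a ≫ A.hom = 0 → a ≫ t = 0 := by
  let J := Σ i : I, { a : G i ⟶ A.obj // F.map a ≫ A.hom = 0 }
  let Z : J → C := fun j => G j.1
  let w : ∐ Z ⟶ A.obj := Sigma.desc fun j => j.2.1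
  obtain ⟨Y, t, q, hT⟩ := distinguished_cocone_triangle w
  have hw : F.map w ≫ A.hom = 0 := by
    refine map_sigma_hom_ext F hF fun j => ?_
    rw [← assoc, ← F.map_comp, Sigma.ι_desc, comp_zero]
    exact j.2.2
  obtain ⟨l, hl⟩ := map_distTriang_desc₂ F hT _ hw
  refine ⟨⟨Y, hP₃ hT (hP _ _ fun j => hPG _) A.prop, l⟩, t, hl.symm, fun i a ha => ?_⟩
  let j : J := ⟨i, a, ha⟩
  have h : Sigma.ι Z j ≫ w = a := Sigma.ι_desc _ _
  rw [← h, assoc, distTriang_comp₁₂ hT, comp_zero]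

include hF hP hP₃ hG hPG in
-- The start `A₀`, one copy of a generator for each map to `d`, gives surjectivity. A map from a
-- generator into the homotopy colimit that dies over `d` factors through a stage `n`, and stage `n
-- + 1` kills it.
lemma Approximation.exists_bijective :
    ∃ A : Approximation F P d, ∀ i : I,
      Function.Bijective fun a : G i ⟶ A.obj => F.map a ≫ A.hom := by
  let J := Σ i : I, F.obj (G i) ⟶ d
  obtain ⟨l, hl⟩ := exists_map_sigma_desc F hF (X := fun j : J => G j.1) fun j => j.2
  let A₀ : Approximation F P d := ⟨_, hP _ _ fun j => hPG _, l⟩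
  choose next t ht ht₀ using Approximation.exists_next F hF P hP hP₃ G hPG (d := d)
  let A (n : ℕ) : Approximation F P d := n.rec A₀ fun _ => next
  obtain ⟨Y, φ, p, q, j, hT, hj, hY, hfac⟩ :=
    exists_homotopyColimit F hF (fun n => (A n).obj) fun n => t (A n)
  obtain ⟨k, hk⟩ := hY d (fun n => (A n).hom) fun n => ht (A n)
  have hS : P (∐ fun n : ULift.{v} ℕ => (A n.down).obj) := hP _ _ fun n => (A n.down).prop
  refine ⟨⟨Y, hP₃ hT hS hS, k⟩, fun i => ⟨?_, fun b => ?_⟩⟩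
  · refine (injective_iff_map_eq_zero
      (AddMonoidHom.mk' (fun a : G i ⟶ Y => F.map a ≫ k) fun a b => by simp)).2 fun a ha => ?_
    obtain ⟨n, b, rfl⟩ := hfac _ (hG i) a
    have hb : F.map b ≫ (A n).hom = 0 := by
      rw [← hk, ← assoc, ← F.map_comp]
      exact ha
    rw [← hj, ← assoc, ht₀ _ _ _ hb, zero_comp]
  · let m : J := ⟨i, b⟩
    refine ⟨Sigma.ι (fun j : J => G j.1) m ≫ j 0, ?_⟩
    dsimp only
    rw [F.map_comp, assoc, hk]
    exact hl m

end

end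

end Brown

/-! ### Induction from compact generators, and Brown representability. -/

section Induction

variable {C : Type u} [Category.{v} C] [HasZeroObject C] [Preadditive C] [HasShift C ℤ]
  [∀ n : ℤ, (shiftFunctor C n).Additive] [Pretriangulated C]
  (P : ObjectProperty C) [P.IsClosedUnderIsomorphisms]

section

variable [HasCoproducts.{v} C] {I : Type v} (G : I → C) (hG : ∀ i, IsCompactObj (G i))
  (h : ∀ t : C, (∀ (i : I) (f : G i ⟶ t), f = 0) → IsZero t)
include hG h

/-- A localizing subcategory that contains a set of compact generators is everything. -/
lemma prop_of_localizing_of_generators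
    (hP : ∀ (J : Type v) (X : J → C), (∀ j, P (X j)) → P (∐ X))
    (hP₃ : ∀ {x y z : C} {u : x ⟶ y} {p : y ⟶ z} {q : z ⟶ x⟦(1 : ℤ)⟧},
      Triangle.mk u p q ∈ distTriang C → P x → P y → P z)
    (hPG : ∀ (i : I) (n : ℤ), P ((G i)⟦n⟧)) (x : C) : P x := by
  -- For the identity functor the approximation is an object of `P` mapping to `x`, bijectively on
  -- maps from shifted generators; its cone therefore vanishes.
  obtain ⟨A, hA⟩ := Approximation.exists_bijective (𝟭 C) (fun J => inferInstance) P hP hP₃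
    (fun i : I × ULift.{v} ℤ => (G i.1)⟦i.2.down⟧) (fun i => (hG _).shift _) (fun i => hPG _ _)
    (d := x)
  obtain ⟨z, p, q, hT⟩ := distinguished_cocone_triangle (show A.obj ⟶ x from A.hom)
  have : IsIso (show A.obj ⟶ x from A.hom) := by
    refine (Triangle.isZero₃_iff_isIso₁ _ hT).1 (h _ fun i =>
      distTriang_hom_eq_zero hT (fun b => ?_) (hA (i, ⟨-1⟩)).1)
    let e : (G i)⟦(0 : ℤ)⟧ ≅ G i := (shiftFunctorZero C ℤ).app _
    obtain ⟨a, ha⟩ := (hA (i, ⟨0⟩)).2 (e.hom ≫ b)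
    exact ⟨e.inv ≫ a, by simpa using e.inv ≫= ha⟩
  exact P.prop_of_iso (asIso (show A.obj ⟶ x from A.hom)) A.prop

/-- To check a property on all objects, it suffices to check it on shifts of compact generators,
provided that it is closed under coproducts and satisfies the conclusion of a five lemma. -/
lemma induction_of_generators
    (hP : ∀ (J : Type v) (X : J → C), (∀ j, P (X j)) → P (∐ X))
    (hP₃ : ∀ {x y z : C} {u : x ⟶ y} {p : y ⟶ z} {q : z ⟶ x⟦(1 : ℤ)⟧},
      Triangle.mk u p q ∈ distTriang C → P x → P y → P (x⟦(1 : ℤ)⟧) → P (y⟦(1 : ℤ)⟧) → P z)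
    (hPG : ∀ (i : I) (n : ℤ), P ((G i)⟦n⟧)) (x : C) : P x := by
  -- `P` need not be stable under shifts, while the five-lemma hypothesis involves shifted vertices;
  -- requiring `P` for all shifts repairs this.
  let Q : ObjectProperty C := fun x => ∀ n : ℤ, P (x⟦n⟧)
  have : Q.IsClosedUnderIsomorphisms :=
    ⟨fun e h n => P.prop_of_iso ((shiftFunctor C n).mapIso e) (h n)⟩
  have hQ : Q x := by
    refine prop_of_localizing_of_generators Q G hG h ?_ ?_ (fun i m n =>
      P.prop_of_iso ((shiftFunctorAdd C m n).app (G i)) (hPG i (m + n))) x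
    · intro J X hX n
      exact P.prop_of_iso (PreservesCoproduct.iso (shiftFunctor C n) X).symm
        (hP _ _ fun j => hX j n)
    · intro x y z u p q hT hx hy n
      exact hP₃ (Triangle.shift_distinguished _ hT n) (hx n) (hy n)
        (P.prop_of_iso ((shiftFunctorAdd C n 1).app x) (hx (n + 1)))
        (P.prop_of_iso ((shiftFunctorAdd C n 1).app y) (hy (n + 1)))
  exact P.prop_of_iso ((shiftFunctorZero C ℤ).app x) (hQ 0)

end

lemma IsCompactlyGenerated.induction (hC : IsCompactlyGenerated C)
    (hP : ∀ [HasCoproducts.{v} C] (J : Type v) (X : J → C), (∀ j, P (X j)) → P (∐ X))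
    (hP₃ : ∀ {x y z : C} {u : x ⟶ y} {p : y ⟶ z} {q : z ⟶ x⟦(1 : ℤ)⟧},
      Triangle.mk u p q ∈ distTriang C → P x → P y → P (x⟦(1 : ℤ)⟧) → P (y⟦(1 : ℤ)⟧) → P z)
    (hPc : ∀ g, IsCompactObj g → P g) (x : C) : P x := by
  obtain ⟨_, I, G, hG, h⟩ := hC
  exact induction_of_generators P G hG h hP hP₃ (fun i n => hPc _ ((hG i).shift n)) x

end Induction

section

variable {C : Type u₁} [Category.{v} C] [HasZeroObject C] [Preadditive C] [HasShift C ℤ]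
  [∀ n : ℤ, (shiftFunctor C n).Additive] [Pretriangulated C]
  {D : Type u₂} [Category.{v} D] [HasZeroObject D] [Preadditive D] [HasShift D ℤ]
  [∀ n : ℤ, (shiftFunctor D n).Additive] [Pretriangulated D]

lemma map_leftComp_exact (F : C ⥤ D) [F.CommShift ℤ] [F.IsTriangulated]
    {x y z : C} {u : x ⟶ y} {p : y ⟶ z} {q : z ⟶ x⟦(1 : ℤ)⟧}
    (hT : Triangle.mk u p q ∈ distTriang C) (w : D) :
    Function.Exact (Preadditive.leftComp w (F.map p)) (Preadditive.leftComp w (F.map u)) := by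
  intro a
  refine ⟨fun h => ?_, ?_⟩
  · obtain ⟨b, rfl⟩ := map_distTriang_desc₂ F hT a h
    exact ⟨b, rfl⟩
  · rintro ⟨b, rfl⟩
    change F.map u ≫ F.map p ≫ b = 0
    rw [← assoc, ← F.map_comp, distTriang_comp₁₂ hT, F.map_zero, zero_comp]

lemma leftComp_exact {x y z : C} {u : x ⟶ y} {p : y ⟶ z} {q : z ⟶ x⟦(1 : ℤ)⟧}
    (hT : Triangle.mk u p q ∈ distTriang C) (w : C) :
    Function.Exact (Preadditive.leftComp w p) (Preadditive.leftComp w u) :=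
  map_leftComp_exact (𝟭 C) hT w

lemma rotate_mk_mem {x y z : C} {u : x ⟶ y} {p : y ⟶ z} {q : z ⟶ x⟦(1 : ℤ)⟧}
    (hT : Triangle.mk u p q ∈ distTriang C) :
    Triangle.mk p q (-u⟦(1 : ℤ)⟧') ∈ distTriang C :=
  rot_of_distTriang _ hT

/-- Brown representability for coproduct-preserving triangulated functors. -/
theorem IsCompactlyGenerated.isLeftAdjoint (hC : IsCompactlyGenerated C) (F : C ⥤ D)
    [F.CommShift ℤ] [F.IsTriangulated]
    (hF : ∀ J : Type v, PreservesColimitsOfShape (Discrete J) F) : F.IsLeftAdjoint := by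
  obtain ⟨_, I, G, hG, h⟩ := hC
  refine Functor.isLeftAdjoint_of_rightAdjointObjIsDefined_eq_top ?_
  ext d
  refine ⟨fun _ => trivial, fun _ => ?_⟩
  -- `A` represents `Hom(F -, d)` on shifted generators. Bijectivity of `θ` passes to coproducts,
  -- and to cones by the five lemma, so `A` represents the functor everywhere.
  obtain ⟨A, hA⟩ := Approximation.exists_bijective F hF ⊤ (fun _ _ _ => trivial)
    (fun _ _ _ => trivial) (fun i : I × ULift.{v} ℤ => (G i.1)⟦i.2.down⟧)
    (fun i => (hG _).shift _) (fun i => trivial) (d := d)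
  let θ (x : C) : (x ⟶ A.obj) →+ (F.obj x ⟶ d) :=
    AddMonoidHom.mk' (fun a => F.map a ≫ A.hom) fun a b => by simp
  have hθ {x y : C} (u : x ⟶ y) : (Preadditive.leftComp d (F.map u)).comp (θ y) =
      (θ x).comp (Preadditive.leftComp A.obj u) := by
    ext a
    change F.map u ≫ F.map a ≫ A.hom = F.map (u ≫ a) ≫ A.hom
    rw [F.map_comp, assoc]
  let P : ObjectProperty C := fun x => Function.Bijective (θ x)
  have : P.IsClosedUnderIsomorphisms := ⟨fun {x y} e h => by
    have h1 : θ y = fun a => F.map e.inv ≫ (θ x (e.hom ≫ a)) := by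
      ext a
      change F.map a ≫ A.hom = F.map e.inv ≫ F.map (e.hom ≫ a) ≫ A.hom
      rw [← assoc, ← F.map_comp, e.inv_hom_id_assoc]
    change Function.Bijective (θ y)
    rw [h1]
    exact (((F.mapIso e).homFromEquiv (Z := d)).bijective.comp h).comp
      (e.symm.homFromEquiv (Z := A.obj)).bijective⟩
  have hP : ∀ x, P x := by
    refine induction_of_generators P G hG h ?_ ?_ fun i n => hA (i, ⟨n⟩)
    · intro J X hX
      refine ⟨fun a b hab => ?_, fun b => ?_⟩
      · refine Sigma.hom_ext _ _ fun j => (hX j).1 ?_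
        change F.map _ ≫ A.hom = F.map _ ≫ A.hom
        rw [F.map_comp, F.map_comp, assoc, assoc]
        exact F.map (Sigma.ι X j) ≫= hab
      · choose a ha using fun j => (hX j).2 (F.map (Sigma.ι X j) ≫ b)
        refine ⟨Sigma.desc a, map_sigma_hom_ext F hF fun j => ?_⟩
        rw [← ha]
        change F.map _ ≫ F.map _ ≫ A.hom = F.map _ ≫ A.hom
        rw [← assoc, ← F.map_comp, Sigma.ι_desc]
    · intro x y z u p q hT hx hy hx' hy'
      have hT' := rotate_mk_mem hT
      have hT'' := rotate_mk_mem hT'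
      exact AddMonoidHom.bijective_of_surjective_of_bijective_of_bijective_of_injective
        _ _ _ _ _ _ _ _ (θ (y⟦(1 : ℤ)⟧)) (θ (x⟦(1 : ℤ)⟧)) (θ z) (θ y) (θ x)
        (hθ _) (hθ _) (hθ _) (hθ _)
        (leftComp_exact hT'' _) (leftComp_exact hT' _) (leftComp_exact hT _)
        (map_leftComp_exact F hT'' _) (map_leftComp_exact F hT' _) (map_leftComp_exact F hT _)
        hy'.2 hx' hy hx.1
  exact Functor.RepresentableBy.isRepresentable (Y := A.obj)
    { homEquiv := fun {x} => Equiv.ofBijective (θ x) (hP x)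
      homEquiv_comp := fun {x y} a b => by
        change F.map (a ≫ b) ≫ A.hom = F.map a ≫ F.map b ≫ A.hom
        rw [F.map_comp, assoc] }

end

/-! ### Extending isomorphisms and partial adjoints from compact objects to all objects. -/

section Homological

variable {C : Type u₁} [Category.{v} C] [HasZeroObject C] [Preadditive C] [HasShift C ℤ]
  [∀ n : ℤ, (shiftFunctor C n).Additive] [Pretriangulated C]

lemma map_exact_of_isHomological (H : C ⥤ AddCommGrpCat.{v}) [H.IsHomological]
    {x y z : C} {u : x ⟶ y} {p : y ⟶ z} {q : z ⟶ x⟦(1 : ℤ)⟧}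
    (hT : Triangle.mk u p q ∈ distTriang C) : Function.Exact (H.map u).hom (H.map p).hom :=
  (ShortComplex.ab_exact_iff_function_exact _).1 (H.map_distinguished_exact _ hT)

lemma IsCompactlyGenerated.isIso_app_of_isHomological (hC : IsCompactlyGenerated C)
    {H H' : C ⥤ AddCommGrpCat.{v}} [H.IsHomological] [H'.IsHomological]
    (hH : ∀ J : Type v, PreservesColimitsOfShape (Discrete J) H)
    (hH' : ∀ J : Type v, PreservesColimitsOfShape (Discrete J) H') (τ : H ⟶ H')
    (h : ∀ g, IsCompactObj g → IsIso (τ.app g)) (x : C) : IsIso (τ.app x) := by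
  let P : ObjectProperty C := fun x => IsIso (τ.app x)
  have : P.IsClosedUnderIsomorphisms := ⟨fun e h => (NatTrans.isIso_app_iff_of_iso τ e).1 h⟩
  refine hC.induction P ?_ ?_ h x
  · intro _ J X hX
    have := hH J
    have := hH' J
    have hX' (j : J) : IsIso (τ.app (X j)) := hX j
    have h1 : sigmaComparison H X ≫ τ.app (∐ X) =
        Limits.Sigma.map (fun j => τ.app (X j)) ≫ sigmaComparison H' X := by
      refine Sigma.hom_ext _ _ fun j => ?_
      rw [ι_comp_sigmaComparison_assoc, Limits.Sigma.ι_map_assoc, ι_comp_sigmaComparison,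
        τ.naturality]
    have h2 : IsIso (sigmaComparison H X ≫ τ.app (∐ X)) := by
      rw [h1]
      infer_instance
    exact IsIso.of_isIso_comp_left (sigmaComparison H X) _
  · intro x y z u p q hT hx hy hx' hy'
    have hT' := rotate_mk_mem hT
    have hT'' := rotate_mk_mem hT'
    have hb {w : C} : P w → Function.Bijective (τ.app w).hom :=
      (ConcreteCategory.isIso_iff_bijective (τ.app w)).1
    have hτ {w w' : C} (a : w ⟶ w') :
        (H'.map a).hom.comp (τ.app w).hom = (τ.app w').hom.comp (H.map a).hom := by
      ext b
      exact congr($((τ.naturality a).symm) b)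
    exact (ConcreteCategory.isIso_iff_bijective (τ.app z)).2
      (AddMonoidHom.bijective_of_surjective_of_bijective_of_bijective_of_injective
        _ _ _ _ _ _ _ _ _ _ (τ.app z).hom _ _ (hτ _) (hτ _) (hτ _) (hτ _)
        (map_exact_of_isHomological H hT) (map_exact_of_isHomological H hT')
        (map_exact_of_isHomological H hT'')
        (map_exact_of_isHomological H' hT) (map_exact_of_isHomological H' hT')
        (map_exact_of_isHomological H' hT'') (hb hx).2 (hb hy) (hb hx') (hb hy').1)

end Homological

section PartialLeftAdjoint

variable {C : Type u₁} [Category.{v} C] {D : Type u₂} [Category.{v} D] (F : D ⥤ C)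

lemma leftAdjointObjIsDefined_iff_exists (x : C) :
    F.leftAdjointObjIsDefined x ↔
      ∃ (l : D) (η : x ⟶ F.obj l), ∀ w, Function.Bijective fun a : l ⟶ w => η ≫ F.map a := by
  constructor
  · intro h
    have : (F ⋙ coyoneda.obj (op x)).IsCorepresentable := h
    let r := (F ⋙ coyoneda.obj (op x)).corepresentableBy
    refine ⟨_, r.homEquiv (𝟙 _), fun w => ?_⟩
    have h : (fun a : (F ⋙ coyoneda.obj (op x)).coreprX ⟶ w => r.homEquiv (𝟙 _) ≫ F.map a) =
      r.homEquiv := funext fun a => (r.homEquiv_eq a).symm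
    exact h ▸ r.homEquiv.bijective
  · rintro ⟨l, η, h⟩
    exact Functor.CorepresentableBy.isCorepresentable (X := l)
      { homEquiv := fun {w} => Equiv.ofBijective _ (h w)
        homEquiv_comp := fun a b => by simp }

instance : F.leftAdjointObjIsDefined.IsClosedUnderIsomorphisms where
  of_iso e h := by
    rw [leftAdjointObjIsDefined_iff_exists] at h ⊢
    obtain ⟨l, η, h⟩ := h
    refine ⟨l, e.inv ≫ η, fun w => ?_⟩
    convert (e.homFromEquiv (Z := F.obj w)).bijective.comp (h w) using 1
    ext a
    simp

/-- Suspending a universal arrow; this supplies the outer terms of the five lemma in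
`IsCompactlyGenerated.isRightAdjoint`. -/
lemma bijective_shift_comp_map [HasShift C ℤ] [HasShift D ℤ] [F.CommShift ℤ] {x : C} {l : D} {η : x ⟶ F.obj l}
    (h : ∀ w, Function.Bijective fun a : l ⟶ w => η ≫ F.map a) (w : D) :
    Function.Bijective fun a : l⟦(1 : ℤ)⟧ ⟶ w =>
      (η⟦(1 : ℤ)⟧' ≫ (F.commShiftIso (1 : ℤ)).inv.app l) ≫ F.map a := by
  let e : (w⟦(-1 : ℤ)⟧)⟦(1 : ℤ)⟧ ≅ w := (shiftFunctorCompIsoId D (-1 : ℤ) 1 (by simp)).app w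
  let φ : (l ⟶ w⟦(-1 : ℤ)⟧) ≃ (l⟦(1 : ℤ)⟧ ⟶ w) :=
    (Functor.FullyFaithful.ofFullyFaithful (shiftFunctor D (1 : ℤ))).homEquiv.trans e.homToEquiv
  let ψ : (x ⟶ F.obj (w⟦(-1 : ℤ)⟧)) ≃ (x⟦(1 : ℤ)⟧ ⟶ F.obj w) :=
    (Functor.FullyFaithful.ofFullyFaithful (shiftFunctor C (1 : ℤ))).homEquiv.trans
      (((F.commShiftIso (1 : ℤ)).symm.app _).trans (F.mapIso e)).homToEquiv
  rw [← φ.bijective.of_comp_iff]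
  convert ψ.bijective.comp (h _) using 1
  ext a
  change (η⟦(1 : ℤ)⟧' ≫ (F.commShiftIso (1 : ℤ)).inv.app l) ≫ F.map (a⟦(1 : ℤ)⟧' ≫ e.hom) =
    (η ≫ F.map a)⟦(1 : ℤ)⟧' ≫ (F.commShiftIso (1 : ℤ)).inv.app _ ≫ F.map e.hom
  simp

variable [HasZeroObject C] [Preadditive C] [HasShift C ℤ]
  [∀ n : ℤ, (shiftFunctor C n).Additive] [Pretriangulated C]
  [HasZeroObject D] [Preadditive D] [HasShift D ℤ]
  [∀ n : ℤ, (shiftFunctor D n).Additive] [Pretriangulated D]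
  [F.CommShift ℤ] [F.IsTriangulated]

/-- A triangulated functor to a compactly generated category has a left adjoint as soon as its
partial left adjoint is defined on compact objects. -/
lemma IsCompactlyGenerated.isRightAdjoint (hC : IsCompactlyGenerated C) [HasCoproducts.{v} D]
    (h : ∀ g, IsCompactObj g → F.leftAdjointObjIsDefined g) : F.IsRightAdjoint := by
  refine Functor.isRightAdjoint_of_leftAdjointObjIsDefined_eq_top ?_
  ext x
  refine ⟨fun _ => trivial, fun _ => hC.induction F.leftAdjointObjIsDefined ?_ ?_ h x⟩
  · intro _ J X hX
    exact Functor.leftAdjointObjIsDefined_colimit (Discrete.functor X) fun j => hX j.as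
  · intro x y z u p q hT hx hy _ _
    rw [leftAdjointObjIsDefined_iff_exists] at hx hy ⊢
    obtain ⟨l, η, hl⟩ := hx
    obtain ⟨m, ν, hm⟩ := hy
    obtain ⟨w, hw⟩ := (hl m).2 (u ≫ ν)
    dsimp only at hw
    obtain ⟨n, p', q', hT'⟩ := distinguished_cocone_triangle w
    -- The fill-in `ξ` to the cone of the map between corepresenting objects is not unique, but any
    -- choice is universal by the five lemma.
    obtain ⟨ξ, hξ₁, hξ₂⟩ : ∃ ξ : z ⟶ F.obj n, p ≫ ξ = ν ≫ F.map p' ∧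
        q ≫ η⟦(1 : ℤ)⟧' = ξ ≫ F.map q' ≫ (F.commShiftIso (1 : ℤ)).hom.app l :=
      complete_distinguished_triangle_morphism _ _ hT (F.map_distinguished _ hT') η ν hw.symm
    refine ⟨n, ξ, fun d => ?_⟩
    let θ {x : C} {l : D} (η : x ⟶ F.obj l) : (l ⟶ d) →+ (x ⟶ F.obj d) :=
      AddMonoidHom.mk' (fun a => η ≫ F.map a) fun a b => by simp
    have hθ {x y : C} {l m : D} (η : x ⟶ F.obj l) (ν : y ⟶ F.obj m) (a : x ⟶ y) (b : l ⟶ m)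
        (hab : a ≫ ν = η ≫ F.map b) : (Preadditive.leftComp (F.obj d) a).comp (θ ν) =
          (θ η).comp (Preadditive.leftComp d b) := by
      ext c
      change a ≫ ν ≫ F.map c = η ≫ F.map (b ≫ c)
      rw [← assoc, hab, F.map_comp, assoc]
    have hT₁ := rotate_mk_mem hT
    have hT₂ := rotate_mk_mem hT₁
    have hT₁' := rotate_mk_mem hT'
    have hT₂' := rotate_mk_mem hT₁'
    refine AddMonoidHom.bijective_of_surjective_of_bijective_of_bijective_of_injective
        _ _ _ _ _ _ _ _ (θ (ν⟦(1 : ℤ)⟧' ≫ (F.commShiftIso (1 : ℤ)).inv.app m))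
        (θ (η⟦(1 : ℤ)⟧' ≫ (F.commShiftIso (1 : ℤ)).inv.app l)) (θ ξ) (θ ν) (θ η)
        (hθ _ _ (-u⟦(1 : ℤ)⟧') (-w⟦(1 : ℤ)⟧') ?_) (hθ _ _ q q' ?_) (hθ _ _ p p' hξ₁)
        (hθ _ _ u w hw.symm)
        (leftComp_exact hT₂' _) (leftComp_exact hT₁' _) (leftComp_exact hT' _)
        (leftComp_exact hT₂ _) (leftComp_exact hT₁ _) (leftComp_exact hT _)
        (bijective_shift_comp_map F hm d).2 (bijective_shift_comp_map F hl d) (hm d) (hl d).1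
    · rw [F.map_neg, Preadditive.neg_comp, Preadditive.comp_neg, assoc,
        ← F.commShiftIso_inv_naturality, ← assoc, ← assoc, ← Functor.map_comp, ← Functor.map_comp,
        hw]
    · rw [← assoc, hξ₂, assoc, assoc, Iso.hom_inv_id_app]
      exact congr(ξ ≫ $(comp_id _))

end PartialLeftAdjoint

lemma bijective_comp_of_isIso {C : Type u} [Category.{v} C] {x y z : C} (u : y ⟶ z) [IsIso u] :
    Function.Bijective fun a : x ⟶ y => a ≫ u := (asIso u).homToEquiv.bijective

/-! ### Rigid objects, exact pairings and duality. -/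

section Pairing

variable {C : Type u} [Category.{v} C] [MonoidalCategory C] [MonoidalClosed C]

open MonoidalClosed

/-- The exact pairing between a rigid object and its dual. -/
@[reducible]
noncomputable def IsRigidObj.exactPairing {x : C} (hx : IsRigidObj x) :
    ExactPairing ((ihom x).obj (𝟙_ C)) x :=
  have := hx x
  have h₁ : x ◁ (curry (ρ_ x).hom ≫ inv (dualTensorHom x x)) ≫ (α_ _ _ _).inv ≫
      (ihom.ev x).app (𝟙_ C) ▷ x = (ρ_ x).hom ≫ (λ_ x).inv := by
    have h : curry (x ◁ (curry (ρ_ x).hom ≫ inv (dualTensorHom x x)) ≫ (α_ _ _ _).inv ≫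
        (ihom.ev x).app (𝟙_ C) ▷ x ≫ (λ_ x).hom) = curry (ρ_ x).hom := by
      rw [curry_natural_left]
      change _ ≫ dualTensorHom x x = _
      rw [Category.assoc, IsIso.inv_hom_id, Category.comp_id]
    rw [← cancel_mono (λ_ x).hom]
    simpa using curry_injective h
  { coevaluation' := curry (ρ_ x).hom ≫ inv (dualTensorHom x x)
    evaluation' := (ihom.ev x).app (𝟙_ C)
    coevaluation_evaluation' := h₁
    evaluation_coevaluation' := by
      generalize curry (ρ_ x).hom ≫ inv (dualTensorHom x x) = η at h₁ ⊢
      -- Maps into the dual are determined by their pairing with `x`. After pairing, exchanging the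
      -- two evaluations reduces the second triangle identity to the first.
      rw [← cancel_mono (ρ_ _).hom]
      apply uncurry_injective
      rw [uncurry_eq, uncurry_eq]
      set e : x ⊗ (ihom x).obj (𝟙_ C) ⟶ 𝟙_ C := (ihom.ev x).app (𝟙_ C)
      change x ◁ ((η ▷ (ihom x).obj (𝟙_ C) ≫ (α_ _ _ _).hom ≫ _ ◁ e) ≫ (ρ_ _).hom) ≫ e =
        x ◁ (((λ_ _).hom ≫ (ρ_ _).inv) ≫ (ρ_ _).hom) ≫ e
      calc
        _ = 𝟙 _ ⊗≫ (x ◁ η) ▷ (ihom x).obj (𝟙_ C) ⊗≫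
            ((x ⊗ (ihom x).obj (𝟙_ C)) ◁ e ≫ e ▷ 𝟙_ C) ⊗≫ 𝟙 _ := by monoidal
        _ = 𝟙 _ ⊗≫ (x ◁ η ≫ (α_ _ _ _).inv ≫ e ▷ x) ▷ (ihom x).obj (𝟙_ C) ⊗≫ e := by
          rw [whisker_exchange]; monoidal
        _ = _ := by rw [h₁]; monoidal }

/-- Both `A ⊗ -` and `hom(x, -)` are right adjoint to `x ⊗ -`; this is the component at `y` of the
canonical comparison. -/
lemma isIso_curry_of_exactPairing {A x : C} [ExactPairing A x] (y : C) :
    IsIso (curry ((α_ x A y).inv ≫ ε_ A x ▷ y ≫ (λ_ y).hom)) := by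
  have : curry ((α_ x A y).inv ≫ ε_ A x ▷ y ≫ (λ_ y).hom) =
      (((tensorLeftAdjunction A x).rightAdjointUniq (ihom.adjunction x)).hom.app y) := by
    apply uncurry_injective
    rw [uncurry_curry, uncurry_eq]
    refine Eq.trans ?_ ((tensorLeftAdjunction A x).rightAdjointUniq_hom_app_counit
      (ihom.adjunction x) y).symm
    simp [tensorLeftAdjunction, tensorLeftHomEquiv]
  rw [this]
  infer_instance

lemma isIso_curry_evaluation {A x : C} [ExactPairing A x] : IsIso (curry (ε_ A x)) := by
  have h : curry (ε_ A x) = (ρ_ A).inv ≫ curry ((α_ x A (𝟙_ C)).inv ≫ ε_ A x ▷ _ ≫ (λ_ _).hom) := by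
    rw [← curry_natural_left]
    congr 1
    rw [unitors_equal]
    simp
  rw [h]
  have := isIso_curry_of_exactPairing (A := A) (x := x) (𝟙_ C)
  infer_instance

/-- After the identification `A ≅ dual x`, the map `dualTensorHom x y` becomes the comparison of
right adjoints in `isIso_curry_of_exactPairing`. -/
lemma isRigidObj_of_exactPairing {A x : C} [ExactPairing A x] : IsRigidObj x := fun y => by
  have h : curry (ε_ A x) ▷ y ≫ dualTensorHom x y =
      curry ((α_ x A y).inv ≫ ε_ A x ▷ y ≫ (λ_ y).hom) := by
    rw [dualTensorHom, ← curry_natural_left]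
    congr 1
    rw [associator_inv_naturality_middle_assoc, ← comp_whiskerRight_assoc,
      whiskerLeft_curry_ihom_ev_app]
  have := isIso_curry_evaluation (A := A) (x := x)
  have h' : IsIso (curry (ε_ A x) ▷ y ≫ dualTensorHom x y) := by
    rw [h]
    exact isIso_curry_of_exactPairing y
  exact IsIso.of_isIso_comp_left (curry (ε_ A x) ▷ y) _

lemma isRigidObj_unit : IsRigidObj (𝟙_ C) := isRigidObj_of_exactPairing (A := 𝟙_ C)

/-- The dual of an object. -/
abbrev dual (x : C) : C := (ihom x).obj (𝟙_ C)

/-- Functoriality of the dual. -/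
abbrev dualMap {x y : C} (h : x ⟶ y) : dual y ⟶ dual x := (pre h).app (𝟙_ C)

lemma dualMap_comp {x y z : C} (f : x ⟶ y) (g : y ⟶ z) :
    dualMap (f ≫ g) = dualMap g ≫ dualMap f := by
  simp [dualMap]

lemma IsRigidObj.tensor {x y : C} (hx : IsRigidObj x) (hy : IsRigidObj y) : IsRigidObj (x ⊗ y) :=
  letI := hx.exactPairing
  letI := hy.exactPairing
  isRigidObj_of_exactPairing (A := TTAdjoints.dual y ⊗ TTAdjoints.dual x)

variable [SymmetricCategory C]

/-- The bijection between morphisms `a ⟶ dual b` and `b ⟶ dual a`, as both correspond to morphisms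
`a ⊗ b ⟶ 𝟙`. -/
def dualSwap (a b : C) : (a ⟶ dual b) ≃ (b ⟶ dual a) where
  toFun g := curry ((β_ a b).hom ≫ uncurry g)
  invFun g := curry ((β_ b a).hom ≫ uncurry g)
  left_inv g := by
    dsimp only
    rw [uncurry_curry, SymmetricCategory.symmetry_assoc, curry_uncurry]
  right_inv g := by
    dsimp only
    rw [uncurry_curry, SymmetricCategory.symmetry_assoc, curry_uncurry]

lemma dualSwap_comp {a a' b : C} (f : a' ⟶ a) (g : a ⟶ dual b) :
    dualSwap a' b (f ≫ g) = dualSwap a b g ≫ dualMap f := by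
  change curry _ = curry _ ≫ _
  rw [curry_pre_app, uncurry_natural_left, BraidedCategory.braiding_naturality_left_assoc]

lemma dualSwap_comp_dualMap {a b b' : C} (g : a ⟶ dual b) (h : b' ⟶ b) :
    dualSwap a b' (g ≫ dualMap h) = h ≫ dualSwap a b g := by
  change curry _ = _ ≫ curry _
  rw [uncurry_pre_app, ← curry_natural_left, BraidedCategory.braiding_naturality_right_assoc]

/-- The morphism from an object to its bidual. -/
def bidual (x : C) : x ⟶ dual (dual x) := dualSwap (dual x) x (𝟙 _)

lemma dualSwap_eq {a b : C} (g : a ⟶ dual b) : dualSwap a b g = bidual b ≫ dualMap g := by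
  rw [bidual, ← dualSwap_comp, Category.comp_id]

lemma bidual_naturality {x y : C} (f : x ⟶ y) :
    f ≫ bidual y = bidual x ≫ dualMap (dualMap f) := by
  rw [← dualSwap_eq, bidual, ← dualSwap_comp_dualMap, Category.id_comp]

lemma IsRigidObj.dual {x : C} (hx : IsRigidObj x) : IsRigidObj (dual x) :=
  have := hx.exactPairing
  have := BraidedCategory.exactPairing_swap (TTAdjoints.dual x) x
  isRigidObj_of_exactPairing (A := x)

lemma IsRigidObj.isIso_bidual {x : C} (hx : IsRigidObj x) : IsIso (bidual x) :=
  letI := hx.exactPairing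
  letI := BraidedCategory.exactPairing_swap (TTAdjoints.dual x) x
  have h : bidual x = curry (ε_ x (TTAdjoints.dual x)) := by
    change curry ((β_ _ _).hom ≫ uncurry (𝟙 _)) = _
    rw [uncurry_id_eq_ev]
    rfl
  h ▸ isIso_curry_evaluation (A := x) (x := TTAdjoints.dual x)

end Pairing

/-! ### Strong monoidal functors and duals. -/

section Functor

variable {C : Type u₁} [Category.{v} C] [MonoidalCategory C] [MonoidalClosed C]
  {D : Type u₂} [Category.{v} D] [MonoidalCategory D] [MonoidalClosed D]
  (F : D ⥤ C) [F.Monoidal]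

open MonoidalClosed Functor.LaxMonoidal Functor.OplaxMonoidal Functor.Monoidal

/-- A monoidal functor sends exact pairings to exact pairings. -/
@[reducible]
def mapExactPairing (A x : D) [ExactPairing A x] : ExactPairing (F.obj A) (F.obj x) where
  coevaluation' := ε F ≫ F.map (η_ A x) ≫ δ F A x
  evaluation' := μ F x A ≫ F.map (ε_ A x) ≫ η F
  coevaluation_evaluation' := by
    have h := F.congr_map (ExactPairing.coevaluation_evaluation A x)
    simp only [F.map_comp, map_whiskerLeft, map_whiskerRight, map_associator_inv,
      map_rightUnitor, map_leftUnitor_inv, Category.assoc, μ_δ_assoc] at h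
    have h' := F.obj x ◁ ε F ≫= (μ F x (𝟙_ D) ≫= (h =≫ (δ F (𝟙_ D) x ≫ η F ▷ F.obj x)))
    simpa [-μ_natural_left, -μ_natural_left_assoc, -μ_natural_right, -μ_natural_right_assoc,
      ← comp_whiskerRight, ← whiskerLeft_comp, ← comp_whiskerRight_assoc,
      ← whiskerLeft_comp_assoc] using h'
  evaluation_coevaluation' := by
    have h := F.congr_map (ExactPairing.evaluation_coevaluation A x)
    simp only [F.map_comp, map_whiskerLeft, map_whiskerRight, map_associator,
      map_leftUnitor, map_rightUnitor_inv, Category.assoc, μ_δ_assoc] at h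
    have h' := ε F ▷ F.obj A ≫= (μ F (𝟙_ D) A ≫= (h =≫ (δ F A (𝟙_ D) ≫ F.obj A ◁ η F)))
    simpa [-μ_natural_left, -μ_natural_left_assoc, -μ_natural_right, -μ_natural_right_assoc,
      ← comp_whiskerRight, ← whiskerLeft_comp, ← comp_whiskerRight_assoc,
      ← whiskerLeft_comp_assoc] using h'

lemma IsRigidObj.map {x : D} (hx : IsRigidObj x) : IsRigidObj (F.obj x) :=
  letI := hx.exactPairing
  letI := mapExactPairing F (TTAdjoints.dual x) x
  isRigidObj_of_exactPairing (A := F.obj (TTAdjoints.dual x))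

/-- The comparison between the image of the dual and the dual of the image. -/
noncomputable def mapDual (x : D) : F.obj (dual x) ⟶ dual (F.obj x) :=
  curry (μ F x _ ≫ F.map ((ihom.ev x).app (𝟙_ D)) ≫ η F)

lemma mapDual_naturality {x y : D} (h : x ⟶ y) :
    F.map (dualMap h) ≫ mapDual F x = mapDual F y ≫ dualMap (F.map h) := by
  rw [mapDual, mapDual, ← curry_natural_left, curry_pre_app]
  congr 1
  have h₁ := μ_natural_right F x (dualMap h)
  have h₂ := μ_natural_left F h (dual y)
  rw [reassoc_of% h₁, reassoc_of% h₂, ← F.map_comp_assoc, ← F.map_comp_assoc,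
    id_tensor_pre_app_comp_ev]

lemma IsRigidObj.isIso_mapDual {x : D} (hx : IsRigidObj x) : IsIso (mapDual F x) :=
  letI := hx.exactPairing
  letI := mapExactPairing F (TTAdjoints.dual x) x
  isIso_curry_evaluation (A := F.obj (TTAdjoints.dual x)) (x := F.obj x)

end Functor

section Dual

variable {C : Type u₁} [Category.{v} C] [MonoidalCategory C] [MonoidalClosed C]
  [SymmetricCategory C]

lemma dualSwap_bidual (x : C) : dualSwap x (dual x) (bidual x) = 𝟙 _ :=
  (dualSwap (dual x) x).symm_apply_apply _

lemma dualSwap_comp_bidual {x y : C} (a : x ⟶ y) : dualSwap x (dual y) (a ≫ bidual y) = dualMap a := by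
  rw [dualSwap_comp, dualSwap_bidual, Category.id_comp]

/-- Up to `dualSwap`, dualizing a map is composing it with `bidual y`, so rigidity of the target
suffices. -/
lemma IsRigidObj.bijective_dualMap {y : C} (hy : IsRigidObj y) (x : C) :
    Function.Bijective (dualMap : (x ⟶ y) → _) := by
  have := hy.isIso_bidual
  convert (dualSwap x (TTAdjoints.dual y)).bijective.comp (bijective_comp_of_isIso (bidual y)) using 1
  ext a
  exact (dualSwap_comp_bidual a).symm

variable {D : Type u₂} [Category.{v} D] [MonoidalCategory D] [MonoidalClosed D]
  [SymmetricCategory D] (F : D ⥤ C) [F.Braided]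

/-- Both sides correspond to the image under `F` of one pairing of `a` with `b`, and a braided
functor respects the swap of its factors. -/
lemma dualSwap_map_comp_mapDual {a b : D} (h : a ⟶ dual b) :
    dualSwap _ _ (F.map h ≫ mapDual F b) = F.map (dualSwap _ _ h) ≫ mapDual F a := by
  have key {a b : D} (h : a ⟶ dual b) : MonoidalClosed.uncurry (F.map h ≫ mapDual F b) =
      Functor.LaxMonoidal.μ F b a ≫ F.map (MonoidalClosed.uncurry h) ≫
        Functor.OplaxMonoidal.η F := by
    rw [mapDual, MonoidalClosed.uncurry_natural_left, MonoidalClosed.uncurry_curry,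
      MonoidalClosed.uncurry_eq, F.map_comp]
    have h₁ := Functor.LaxMonoidal.μ_natural_right F b h
    rw [reassoc_of% h₁, Category.assoc]
  apply MonoidalClosed.uncurry_injective
  rw [key]
  change MonoidalClosed.uncurry (MonoidalClosed.curry ((β_ _ _).hom ≫ _)) =
    _ ≫ F.map (MonoidalClosed.uncurry (MonoidalClosed.curry ((β_ _ _).hom ≫ _))) ≫ _
  rw [MonoidalClosed.uncurry_curry, MonoidalClosed.uncurry_curry, key, F.map_comp, Category.assoc,
    Functor.LaxBraided.braided_assoc]

variable {F}

/-- If `fDown₁ ⊣ F ⊣ fDown`, the canonical map `dual (fDown₁ w) ⟶ fDown (dual w)`. -/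
noncomputable def dualLeftAdjointHom {fDown₁ fDown : C ⥤ D} (adj₁ : fDown₁ ⊣ F)
    (adj₀ : F ⊣ fDown) (w : C) : dual (fDown₁.obj w) ⟶ fDown.obj (dual w) :=
  adj₀.homEquiv _ _ (mapDual F (fDown₁.obj w) ≫ dualMap (adj₁.unit.app w))

lemma dualLeftAdjointHom_naturality {fDown₁ fDown : C ⥤ D} (adj₁ : fDown₁ ⊣ F)
    (adj₀ : F ⊣ fDown) {w w' : C} (a : w ⟶ w') :
    dualMap (fDown₁.map a) ≫ dualLeftAdjointHom adj₁ adj₀ w =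
      dualLeftAdjointHom adj₁ adj₀ w' ≫ fDown.map (dualMap a) := by
  rw [dualLeftAdjointHom, dualLeftAdjointHom, ← adj₀.homEquiv_naturality_left,
    ← adj₀.homEquiv_naturality_right, reassoc_of% @mapDual_naturality, Category.assoc, ← dualMap_comp,
    ← dualMap_comp]
  congr 3
  exact (adj₁.unit.naturality a).symm

end Dual

/-! ### Exactness without shift data, and existence of further right adjoints. -/

section ExactFunctor

variable {C : Type u} [Category.{v} C] [HasZeroObject C] [Preadditive C] [HasShift C ℤ]
  [∀ n : ℤ, (shiftFunctor C n).Additive] [Pretriangulated C]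
  {D : Type u₁} [Category.{v} D] [HasZeroObject D] [Preadditive D] [HasShift D ℤ]
  [∀ n : ℤ, (shiftFunctor D n).Additive] [Pretriangulated D]
  {E : Type u₂} [Category.{v} E] [HasZeroObject E] [Preadditive E] [HasShift E ℤ]
  [∀ n : ℤ, (shiftFunctor E n).Additive] [Pretriangulated E]

/-- A functor which sends the first two morphisms of a distinguished triangle to the first two
morphisms of a distinguished triangle. -/
def MapsDistinguished (F : C ⥤ D) : Prop :=
  ∀ ⦃x y z : C⦄ (u : x ⟶ y) (p : y ⟶ z) (q : z ⟶ x⟦(1 : ℤ)⟧), Triangle.mk u p q ∈ distTriang C →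
    ∃ r, Triangle.mk (F.map u) (F.map p) r ∈ distTriang D

lemma MapsDistinguished.comp {F : C ⥤ D} {G : D ⥤ E} (hF : MapsDistinguished F)
    (hG : MapsDistinguished G) : MapsDistinguished (F ⋙ G) := fun _ _ _ _ _ _ hT =>
  let ⟨_, hT'⟩ := hF _ _ _ hT
  hG _ _ _ hT'

lemma mapsDistinguished_of_isTriangulated (F : C ⥤ D) [F.CommShift ℤ] [F.IsTriangulated] :
    MapsDistinguished F := fun _ _ _ _ _ _ hT => ⟨_, F.map_distinguished _ hT⟩

lemma MapsDistinguished.rightAdjoint {F : C ⥤ D} {G : D ⥤ C} (adj : F ⊣ G) [F.CommShift ℤ]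
    [F.IsTriangulated] : MapsDistinguished G :=
  letI := adj.rightAdjointCommShift ℤ
  have := adj.commShift_of_leftAdjoint ℤ
  have := adj.isTriangulated_rightAdjoint
  mapsDistinguished_of_isTriangulated G

/-- Exactness of `Hom(z, F -)` at the middle vertex involves only the first two maps of a triangle,
so no commutation of `F` with shifts is needed. -/
lemma MapsDistinguished.isHomological {F : C ⥤ D} [F.PreservesZeroMorphisms]
    (hF : MapsDistinguished F) (z : D) : (F ⋙ preadditiveCoyoneda.obj (op z)).IsHomological where
  exact T hT := by
    obtain ⟨_, hT'⟩ := hF T.mor₁ T.mor₂ T.mor₃ hT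
    exact (preadditiveCoyoneda.obj (op z)).map_distinguished_exact _ hT'

lemma IsCompactlyGenerated.isIso_app_of_mapsDistinguished (hC : IsCompactlyGenerated C)
    (hD : IsCompactlyGenerated D) {F F' : C ⥤ D} [F.PreservesZeroMorphisms]
    [F'.PreservesZeroMorphisms] (hF : MapsDistinguished F) (hF' : MapsDistinguished F')
    (hFc : ∀ J : Type v, PreservesColimitsOfShape (Discrete J) F)
    (hFc' : ∀ J : Type v, PreservesColimitsOfShape (Discrete J) F') (τ : F ⟶ F')
    (h : ∀ g, IsCompactObj g → IsIso (τ.app g)) (x : C) : IsIso (τ.app x) := by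
  refine hD.isIso _ fun z hz => ?_
  have := hF.isHomological z
  have := hF'.isHomological z
  have := hC.isIso_app_of_isHomological (H := F ⋙ preadditiveCoyoneda.obj (op z))
    (H' := F' ⋙ preadditiveCoyoneda.obj (op z))
    (fun J => have := hFc J; have := hz J; inferInstance)
    (fun J => have := hFc' J; have := hz J; inferInstance)
    (Functor.whiskerRight τ _)
    (fun g hg => have := h g hg; by dsimp; infer_instance) x
  exact (ConcreteCategory.isIso_iff_bijective _).1 this

end ExactFunctor

section Existence

variable {C : Type u₁} [Category.{v} C] [HasZeroObject C] [Preadditive C] [HasShift C ℤ]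
  [∀ n : ℤ, (shiftFunctor C n).Additive] [Pretriangulated C]
  {D : Type u₂} [Category.{v} D] [HasZeroObject D] [Preadditive D] [HasShift D ℤ]
  [∀ n : ℤ, (shiftFunctor D n).Additive] [Pretriangulated D]

lemma IsCompactlyGenerated.isLeftAdjoint_rightAdjoint (hC : IsCompactlyGenerated C)
    (hD : IsCompactlyGenerated D) {L : D ⥤ C} {R : C ⥤ D} (adj : L ⊣ R) [L.CommShift ℤ]
    [L.IsTriangulated] (hL : ∀ t : D, IsCompactObj t → IsCompactObj (L.obj t)) :
    R.IsLeftAdjoint :=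
  letI := adj.rightAdjointCommShift ℤ
  have := adj.commShift_of_leftAdjoint ℤ
  have := adj.isTriangulated_rightAdjoint
  have := adj.right_adjoint_additive
  hC.isLeftAdjoint R (preservesCoproducts_of_preserves_compact hC hD adj hL)

lemma IsCompactlyGenerated.isLeftAdjoint_rightAdjoint_rightAdjoint (hC : IsCompactlyGenerated C)
    (hD : IsCompactlyGenerated D) {L : D ⥤ C} {R : C ⥤ D} {S : D ⥤ C} (adj : L ⊣ R)
    (adj' : R ⊣ S) [L.CommShift ℤ] [L.IsTriangulated]
    (hR : ∀ t : C, IsCompactObj t → IsCompactObj (R.obj t)) : S.IsLeftAdjoint :=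
  letI := adj.rightAdjointCommShift ℤ
  have := adj.commShift_of_leftAdjoint ℤ
  have := adj.isTriangulated_rightAdjoint
  hD.isLeftAdjoint_rightAdjoint hC adj' hR

end Existence

section

variable {C : Type u₁} [Category.{v} C] [MonoidalCategory C] [SymmetricCategory C]
  [MonoidalClosed C]
  {D : Type u₂} [Category.{v} D] [HasZeroObject D] [Preadditive D] [HasShift D ℤ]
  [∀ n : ℤ, (shiftFunctor D n).Additive] [Pretriangulated D]
  [MonoidalCategory D] [SymmetricCategory D] [MonoidalClosed D] {f : D ⥤ C} [f.Braided]

/-- For `g` compact, `Hom(g, dual (fDown₁ w)) = Hom(fDown₁ w, dual g) = Hom(w, f (dual g)) = Hom(w,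
dual (f g)) = Hom(f g, dual w) = Hom(g, fDown (dual w))`. -/
lemma isIso_dualLeftAdjointHom (hD : IsRigidlyCompactlyGenerated D) {fDown₁ fDown : C ⥤ D} (adj₁ : fDown₁ ⊣ f)
    (adj₀ : f ⊣ fDown) (w : C) : IsIso (dualLeftAdjointHom adj₁ adj₀ w) := by
  refine hD.1.isIso _ fun g hg => ?_
  have := ((hD.2 g).1 hg).isIso_mapDual f
  let e₁ := (dualSwap g (fDown₁.obj w)).trans (adj₁.homEquiv w (dual g))
  let e₂ := (adj₀.homEquiv g (dual w)).symm.trans (dualSwap (f.obj g) w)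
  rw [← e₂.bijective.of_comp_iff']
  convert (bijective_comp_of_isIso (mapDual f g)).comp e₁.bijective using 1
  ext a
  change dualSwap _ _ ((adj₀.homEquiv g (dual w)).symm (a ≫ dualLeftAdjointHom adj₁ adj₀ w)) =
    adj₁.homEquiv _ _ (dualSwap _ _ a) ≫ mapDual f g
  rw [adj₀.homEquiv_naturality_left_symm, dualLeftAdjointHom, Equiv.symm_apply_apply,
    ← Category.assoc, dualSwap_comp_dualMap, dualSwap_map_comp_mapDual, adj₁.homEquiv_unit,
    Category.assoc]

/-- `fDown₁` preserves compacts because `f` preserves coproducts, and `fDown z ≅ dual (fDown₁ (dual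
z))` for `z` compact. -/
lemma isCompactObj_of_leftAdjoint [Preadditive C] (hC : IsRigidlyCompactlyGenerated C)
    (hD : IsRigidlyCompactlyGenerated D) {fDown₁ fDown : C ⥤ D} (adj₁ : fDown₁ ⊣ f)
    (adj₀ : f ⊣ fDown) [f.Additive] (hf : ∀ J : Type v, PreservesColimitsOfShape (Discrete J) f)
    {z : C} (hz : IsCompactObj z) : IsCompactObj (fDown.obj z) := by
  have := adj₁.left_adjoint_additive
  have := hD.1.1
  have hz' := (hC.2 z).1 hz
  have := hz'.isIso_bidual
  have := isIso_dualLeftAdjointHom hD adj₁ adj₀ (dual z)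
  have h := IsCompactObj.of_adjunction adj₁ hf ((hC.2 _).2 hz'.dual)
  exact ((hD.2 _).2 ((hD.2 _).1 h).dual).of_iso
    (asIso (dualLeftAdjointHom adj₁ adj₀ (dual z)) ≪≫ (fDown.mapIso (asIso (bidual z))).symm)

end

section

variable {C : Type u₁} [Category.{v} C] [HasZeroObject C] [Preadditive C] [HasShift C ℤ]
  [∀ n : ℤ, (shiftFunctor C n).Additive] [Pretriangulated C]
  [MonoidalCategory C] [SymmetricCategory C] [MonoidalClosed C]
  {D : Type u₂} [Category.{v} D] [HasZeroObject D] [Preadditive D] [HasShift D ℤ]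
  [∀ n : ℤ, (shiftFunctor D n).Additive] [Pretriangulated D]
  [MonoidalCategory D] [SymmetricCategory D] [MonoidalClosed D]
  (hC : IsRigidlyCompactlyGenerated C) (hD : IsRigidlyCompactlyGenerated D)
  {f : D ⥤ C} [f.Braided]

include hC hD in
-- The isomorphism `dual (fDown₁ w) ≅ fDown (dual w)` dictates the candidate `M = dual (fDown (dual
-- z))`. It corepresents `Hom(z, f -)` on rigid objects by duality, hence everywhere, since both
-- sides are homological and preserve coproducts.
lemma leftAdjointObjIsDefined_of_isCompactObj [f.CommShift ℤ] [f.IsTriangulated]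
    (hf : ∀ J : Type v, PreservesColimitsOfShape (Discrete J) f) {fDown : C ⥤ D}
    (adj₀ : f ⊣ fDown) (hfDown : ∀ z : C, IsCompactObj z → IsCompactObj (fDown.obj z))
    {z : C} (hz : IsCompactObj z) : f.leftAdjointObjIsDefined z := by
  have hz' := (hC.2 z).1 hz
  have hr : IsRigidObj (fDown.obj (dual z)) :=
    (hD.2 _).1 (hfDown _ ((hC.2 _).2 hz'.dual))
  let M : D := dual (fDown.obj (dual z))
  have hM : IsRigidObj M := hr.dual
  let Φ (y : D) (φ : z ⟶ f.obj y) : M ⟶ dual (dual y) :=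
    dualMap (adj₀.homEquiv _ _ (mapDual f y ≫ dualMap φ))
  have hΦ {y y' : D} (φ : z ⟶ f.obj y) (a : y ⟶ y') :
      Φ y' (φ ≫ f.map a) = Φ y φ ≫ dualMap (dualMap a) := by
    change dualMap _ = dualMap _ ≫ _
    rw [← dualMap_comp, ← adj₀.homEquiv_naturality_left, reassoc_of% @mapDual_naturality, ← dualMap_comp]
  have hΦ' {y : D} (hy : IsRigidObj y) : Function.Bijective (Φ y) := by
    have := hy.isIso_mapDual f
    have h₁ : Function.Bijective fun a : dual (f.obj y) ⟶ dual z => mapDual f y ≫ a :=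
      ((asIso (mapDual f y)).symm.homFromEquiv (Z := dual z)).bijective
    exact (hr.bijective_dualMap _).comp ((adj₀.homEquiv _ _).bijective.comp
      (h₁.comp ((hy.map f).bijective_dualMap z)))
  -- The universal arrow is the one that `Φ` matches with the identity of `M`, seen through
  -- `bidual`.
  obtain ⟨u, hu⟩ := (hΦ' hM).2 (bidual M)
  have hb {y : D} (hy : IsRigidObj y) : Function.Bijective fun a : M ⟶ y => u ≫ f.map a := by
    have := hy.isIso_bidual
    rw [← (hΦ' hy).of_comp_iff']
    convert bijective_comp_of_isIso (x := M) (bidual y) using 1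
    ext a
    change Φ y (u ≫ f.map a) = a ≫ bidual y
    rw [hΦ, hu, bidual_naturality]
  have hMc : IsCompactObj M := (hD.2 _).2 hM
  let τ : preadditiveCoyoneda.obj (op M) ⟶ f ⋙ preadditiveCoyoneda.obj (op z) :=
    { app := fun y => AddCommGrpCat.ofHom
        (AddMonoidHom.mk' (fun a : M ⟶ y => u ≫ f.map a) fun a b =>
          (congr(u ≫ $(f.map_add (f := a) (g := b)))).trans (Preadditive.comp_add _ _ _ _ _ _))
      naturality := fun y y' a => by
        ext b
        let b' : M ⟶ y := b
        change u ≫ f.map (b' ≫ a) = (u ≫ f.map b') ≫ f.map a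
        rw [f.map_comp, Category.assoc] }
  refine (leftAdjointObjIsDefined_iff_exists f z).2 ⟨M, u, fun y => ?_⟩
  have := hD.1.isIso_app_of_isHomological hMc
    (fun J => have := hf J; have := hz J; inferInstance) τ
    (fun g hg => (ConcreteCategory.isIso_iff_bijective _).2 (hb ((hD.2 g).1 hg))) y
  exact (ConcreteCategory.isIso_iff_bijective _).1 this

end

/-! ### The projection formula and Grothendieck duality. -/

section Projection

variable {C : Type u₁} [Category.{v} C] [MonoidalCategory C]
  {D : Type u₂} [Category.{v} D] [MonoidalCategory D]

open Functor.LaxMonoidal Functor.OplaxMonoidal Functor.Monoidal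

/-- `F` carries the unit of `- ⊗ A ⊣ - ⊗ y` to that of `- ⊗ F A ⊣ - ⊗ F y`, up to the monoidal
structure maps. -/
lemma map_coevaluation_comp_δ (F : D ⥤ C) [F.Monoidal] (g A y : D) [ExactPairing A y] :
    letI := mapExactPairing F A y
    F.map ((ρ_ g).inv ≫ g ◁ η_ A y ≫ (α_ g A y).inv) ≫ δ F (g ⊗ A) y =
      (ρ_ (F.obj g)).inv ≫ F.obj g ◁ η_ (F.obj A) (F.obj y) ≫ (α_ _ _ _).inv ≫
        μ F g A ▷ F.obj y := by
  change _ = (ρ_ (F.obj g)).inv ≫ F.obj g ◁ (ε F ≫ F.map (η_ A y) ≫ δ F A y) ≫ (α_ _ _ _).inv ≫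
        μ F g A ▷ F.obj y
  simp only [F.map_comp, map_whiskerLeft, map_associator_inv, map_rightUnitor_inv, Category.assoc,
    μ_δ_assoc, μ_δ, Category.comp_id, whiskerLeft_comp]

variable {F : D ⥤ C} [F.Monoidal] {R : C ⥤ D} (adj : F ⊣ R)

/-- The projection morphism of an adjunction whose left adjoint is monoidal. -/
def projection (x : C) (y : D) : R.obj x ⊗ y ⟶ R.obj (x ⊗ F.obj y) :=
  adj.homEquiv _ _ (δ F (R.obj x) y ≫ adj.counit.app x ▷ F.obj y)

lemma homEquiv_symm_projection (x : C) (y : D) :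
    (adj.homEquiv _ _).symm (projection adj x y) =
      δ F (R.obj x) y ≫ adj.counit.app x ▷ F.obj y :=
  Equiv.symm_apply_apply _ _

lemma projection_naturality_right (x : C) {y y' : D} (a : y ⟶ y') :
    R.obj x ◁ a ≫ projection adj x y' = projection adj x y ≫ R.map (x ◁ F.map a) := by
  rw [projection, projection, ← adj.homEquiv_naturality_left, ← adj.homEquiv_naturality_right,
    Category.assoc, ← δ_natural_right_assoc]
  exact congr(adj.homEquiv _ _ (δ F _ _ ≫ $(whisker_exchange (adj.counit.app x) (F.map a))))

lemma projection_naturality_left {x x' : C} (a : x ⟶ x') (y : D) :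
    R.map a ▷ y ≫ projection adj x' y = projection adj x y ≫ R.map (a ▷ F.obj y) := by
  rw [projection, projection, ← adj.homEquiv_naturality_left, ← adj.homEquiv_naturality_right,
    Category.assoc, ← comp_whiskerRight, ← δ_natural_left_assoc, ← comp_whiskerRight]
  congr 3
  exact adj.counit.naturality a

/-- By Yoneda: `Hom(g, R x ⊗ y) = Hom(g ⊗ A, R x) = Hom(F g ⊗ F A, x) = Hom(F g, x ⊗ F y) = Hom(g, R
(x ⊗ F y))`. -/
lemma isIso_projection_of_exactPairing (x : C) (A y : D) [ExactPairing A y] :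
    IsIso (projection adj x y) := by
  let := mapExactPairing F A y
  refine isIso_of_yoneda_map_bijective _ fun g => ?_
  let e₁ := tensorRightHomEquiv g A y (R.obj x)
  let e₂ := (adj.homEquiv (g ⊗ A) x).symm
  let e₃ : (F.obj (g ⊗ A) ⟶ x) ≃ (F.obj g ⊗ F.obj A ⟶ x) := (μIso F g A).symm.homFromEquiv
  let e₄ := tensorRightHomEquiv (F.obj g) (F.obj A) (F.obj y) x
  let e₅ := (adj.homEquiv g (x ⊗ F.obj y)).symm
  rw [← e₁.bijective.of_comp_iff, ← e₅.bijective.of_comp_iff']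
  convert (e₂.trans (e₃.trans e₄)).bijective using 1
  ext b
  change (adj.homEquiv _ _).symm (((ρ_ _).inv ≫ g ◁ η_ A y ≫ (α_ _ _ _).inv ≫ b ▷ y) ≫
    projection adj x y) = (ρ_ _).inv ≫ F.obj g ◁ η_ (F.obj A) (F.obj y) ≫ (α_ _ _ _).inv ≫
      (μ F g A ≫ (adj.homEquiv _ _).symm b) ▷ F.obj y
  have h := map_coevaluation_comp_δ F g A y =≫ ((adj.homEquiv _ _).symm b ▷ F.obj y)
  simp only [Category.assoc] at h
  rw [adj.homEquiv_naturality_left_symm, homEquiv_symm_projection, comp_whiskerRight, ← h,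
    adj.homEquiv_counit, comp_whiskerRight, δ_natural_left_assoc]
  simp only [F.map_comp, Category.assoc]

lemma map_coevaluation_eq (w : C) (A y : D) [ExactPairing A y] :
    letI := mapExactPairing F A y
    R.map ((ρ_ w).inv ≫ w ◁ η_ (F.obj A) (F.obj y) ≫ (α_ _ _ _).inv) =
      ((ρ_ _).inv ≫ R.obj w ◁ η_ A y ≫ (α_ _ _ _).inv) ≫ projection adj w A ▷ y ≫
        projection adj (w ⊗ F.obj A) y := by
  let := mapExactPairing F A y
  apply (adj.homEquiv _ _).symm.injective
  have h := map_coevaluation_comp_δ F (R.obj w) A y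
  have h' : F.map (projection adj w A) ≫ adj.counit.app _ = _ :=
    (adj.homEquiv_counit _ _ _).symm.trans (homEquiv_symm_projection adj w A)
  rw [adj.homEquiv_naturality_left_symm, adj.homEquiv_naturality_left_symm,
    homEquiv_symm_projection, ← δ_natural_left_assoc, ← comp_whiskerRight, h', reassoc_of% h,
    ← comp_whiskerRight, μ_δ_assoc, adj.homEquiv_counit, adj.counit_naturality]
  have key {p : C} (c : p ⟶ w) (e : 𝟙_ C ⟶ F.obj A ⊗ F.obj y) :
      c ≫ (ρ_ w).inv ≫ w ◁ e ≫ (α_ _ _ _).inv =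
        (ρ_ p).inv ≫ p ◁ e ≫ (α_ _ _ _).inv ≫ (c ▷ F.obj A) ▷ F.obj y := by
    rw [rightUnitor_inv_naturality_assoc, ← whisker_exchange_assoc,
        associator_inv_naturality_left]
  exact key _ _

variable {S : D ⥤ C} (adj' : R ⊣ S)

/-- The comparison morphism from the tensor product with `S.obj (𝟙_ D)` to `S`. -/
noncomputable def tensorComparison (y : D) [IsIso (projection adj (S.obj (𝟙_ D)) y)] :
    S.obj (𝟙_ D) ⊗ F.obj y ⟶ S.obj y :=
  adj'.homEquiv _ _ (inv (projection adj (S.obj (𝟙_ D)) y) ≫ adj'.counit.app (𝟙_ D) ▷ y ≫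
    (λ_ y).hom)

lemma tensorComparison_naturality {y y' : D} (a : y ⟶ y')
    [IsIso (projection adj (S.obj (𝟙_ D)) y)] [IsIso (projection adj (S.obj (𝟙_ D)) y')] :
    S.obj (𝟙_ D) ◁ F.map a ≫ tensorComparison adj adj' y' =
      tensorComparison adj adj' y ≫ S.map a := by
  rw [tensorComparison, tensorComparison, ← adj'.homEquiv_naturality_left,
    ← adj'.homEquiv_naturality_right]
  congr 1
  have h : R.map (S.obj (𝟙_ D) ◁ F.map a) ≫ inv (projection adj (S.obj (𝟙_ D)) y') =
      inv (projection adj (S.obj (𝟙_ D)) y) ≫ R.obj (S.obj (𝟙_ D)) ◁ a := by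
    rw [IsIso.comp_inv_eq, Category.assoc, IsIso.eq_inv_comp, projection_naturality_right]
  rw [reassoc_of% h, whisker_exchange_assoc]
  simp

/-- By Yoneda: `Hom(w, S 𝟙 ⊗ F y) = Hom(R (w ⊗ F A), 𝟙) = Hom(R w ⊗ A, 𝟙) = Hom(R w, y) = Hom(w, S
y)`, the middle step being the projection formula. -/
lemma isIso_tensorComparison_of_exactPairing (A y : D) [ExactPairing A y]
    [∀ x, IsIso (projection adj x y)] [∀ x, IsIso (projection adj x A)] :
    IsIso (tensorComparison adj adj' y) := by
  let := mapExactPairing F A y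
  refine isIso_of_yoneda_map_bijective _ fun w => ?_
  let e₁ := tensorRightHomEquiv w (F.obj A) (F.obj y) (S.obj (𝟙_ D))
  let e₂ := (adj'.homEquiv (w ⊗ F.obj A) (𝟙_ D)).symm
  let e₃ : (R.obj (w ⊗ F.obj A) ⟶ 𝟙_ D) ≃ (R.obj w ⊗ A ⟶ 𝟙_ D) :=
    (asIso (projection adj w A)).symm.homFromEquiv
  let e₄ := tensorRightHomEquiv (R.obj w) A y (𝟙_ D)
  let e₅ : (R.obj w ⟶ 𝟙_ D ⊗ y) ≃ (R.obj w ⟶ y) := (λ_ y).homToEquiv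
  let e₆ := (adj'.homEquiv w y).symm
  rw [← e₁.bijective.of_comp_iff, ← e₆.bijective.of_comp_iff']
  convert (e₂.trans (e₃.trans (e₄.trans e₅))).bijective using 1
  ext b
  change (adj'.homEquiv _ _).symm (((ρ_ _).inv ≫ w ◁ η_ (F.obj A) (F.obj y) ≫ (α_ _ _ _).inv ≫
    b ▷ F.obj y) ≫ tensorComparison adj adj' y) = ((ρ_ _).inv ≫ R.obj w ◁ η_ A y ≫
      (α_ _ _ _).inv ≫ (projection adj w A ≫ (adj'.homEquiv _ _).symm b) ▷ y) ≫ (λ_ y).hom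
  have h : R.map (b ▷ F.obj y) ≫ inv (projection adj (S.obj (𝟙_ D)) y) =
      inv (projection adj (w ⊗ F.obj A) y) ≫ R.map b ▷ y := by
    rw [IsIso.comp_inv_eq, Category.assoc, IsIso.eq_inv_comp, projection_naturality_left]
  have h' : R.map ((ρ_ w).inv ≫ w ◁ η_ (F.obj A) (F.obj y) ≫ (α_ _ _ _).inv ≫ b ▷ F.obj y) =
      R.map ((ρ_ w).inv ≫ w ◁ η_ (F.obj A) (F.obj y) ≫ (α_ _ _ _).inv) ≫
        R.map (b ▷ F.obj y) := by
    simp only [R.map_comp, Category.assoc]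
  rw [adj'.homEquiv_naturality_left_symm, tensorComparison, Equiv.symm_apply_apply, h',
    map_coevaluation_eq adj, Category.assoc, reassoc_of% h, adj'.homEquiv_counit]
  simp only [comp_whiskerRight, Category.assoc, IsIso.hom_inv_id_assoc]

end Projection

section Triangulated

variable {C : Type u} [Category.{v} C] [HasZeroObject C] [Preadditive C] [HasShift C ℤ]
  [∀ n : ℤ, (shiftFunctor C n).Additive] [Pretriangulated C]
  {D : Type u₁} [Category.{v} D] [HasZeroObject D] [Preadditive D] [HasShift D ℤ]
  [∀ n : ℤ, (shiftFunctor D n).Additive] [Pretriangulated D]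

lemma MapsDistinguished.of_iso {F G : C ⥤ D} (hF : MapsDistinguished F) (e : F ≅ G) :
    MapsDistinguished G := fun x y z u p q hT => by
  obtain ⟨r, hT'⟩ := hF u p q hT
  exact ⟨e.inv.app z ≫ r ≫ (e.hom.app x)⟦(1 : ℤ)⟧',
    isomorphic_distinguished _ hT' _ (Triangle.isoMk _ _ (e.symm.app x) (e.symm.app y)
      (e.symm.app z) (e.inv.naturality u) (e.inv.naturality p) (by
        change (e.inv.app z ≫ r ≫ (e.hom.app x)⟦(1 : ℤ)⟧') ≫ (e.inv.app x)⟦(1 : ℤ)⟧' =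
          e.inv.app z ≫ r
        rw [Category.assoc, Category.assoc, ← CategoryTheory.Functor.map_comp, Iso.hom_inv_id_app,
          CategoryTheory.Functor.map_id]
        exact congr(_ ≫ $(Category.comp_id r))))⟩

lemma mapsDistinguished_tensorLeft [MonoidalCategory C] [SymmetricCategory C] [MonoidalClosed C]
    [TensorTriangulated C] (W : C) : MapsDistinguished (tensorLeft W) :=
  MapsDistinguished.of_iso (F := tensorRight W)
    (fun _ _ _ _ _ _ hT => ⟨_, TensorTriangulated.tensor_exact W _ hT⟩)
    (BraidedCategory.tensorLeftIsoTensorRight W).symm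

end Triangulated

lemma IsRigidlyCompactlyGenerated.isCompactObj_map {C : Type u₁} [Category.{v} C] [Preadditive C]
    [MonoidalCategory C] [MonoidalClosed C] (hC : IsRigidlyCompactlyGenerated C)
    {D : Type u₂} [Category.{v} D] [Preadditive D] [MonoidalCategory D] [MonoidalClosed D]
    (hD : IsRigidlyCompactlyGenerated D) (f : D ⥤ C) [f.Monoidal] {t : D} (ht : IsCompactObj t) :
    IsCompactObj (f.obj t) :=
  (hC.2 _).2 (((hD.2 _).1 ht).map f)

section

variable {C : Type u₁} [Category.{v} C] [HasZeroObject C] [Preadditive C] [HasShift C ℤ]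
  [∀ n : ℤ, (shiftFunctor C n).Additive] [Pretriangulated C]
  [MonoidalCategory C] [SymmetricCategory C] [MonoidalClosed C] [TensorTriangulated C]
  {D : Type u₂} [Category.{v} D] [HasZeroObject D] [Preadditive D] [HasShift D ℤ]
  [∀ n : ℤ, (shiftFunctor D n).Additive] [Pretriangulated D]
  [MonoidalCategory D] [SymmetricCategory D] [MonoidalClosed D] [TensorTriangulated D]
  (hC : IsRigidlyCompactlyGenerated C) (hD : IsRigidlyCompactlyGenerated D)
  {f : D ⥤ C} [f.Monoidal] [f.CommShift ℤ] [f.IsTriangulated]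
  (hf : ∀ J : Type v, PreservesColimitsOfShape (Discrete J) f)

include hC hD hf in
/-- The projection formula. -/
lemma isIso_projection {fDown : C ⥤ D} (adj₀ : f ⊣ fDown) (x : C) (y : D) :
    IsIso (projection adj₀ x y) := by
  have := adj₀.right_adjoint_additive
  have := preservesCoproducts_of_preserves_compact hC.1 hD.1 adj₀
    fun t ht => hC.isCompactObj_map hD f ht
  -- Both sides are exact and preserve coproducts in `y`, so only compact, hence rigid, `y` need
  -- checking.
  let τ : tensorLeft (fDown.obj x) ⟶ (f ⋙ tensorLeft x) ⋙ fDown :=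
    { app := fun y => projection adj₀ x y
      naturality := fun y y' a => projection_naturality_right adj₀ x a }
  exact hD.1.isIso_app_of_mapsDistinguished hD.1 (mapsDistinguished_tensorLeft _)
    (((mapsDistinguished_of_isTriangulated f).comp (mapsDistinguished_tensorLeft x)).comp
      (MapsDistinguished.rightAdjoint adj₀)) (fun J => inferInstance)
    (fun J => have := hf J; inferInstance) τ
    (fun g hg => letI := ((hD.2 g).1 hg).exactPairing
      isIso_projection_of_exactPairing adj₀ x (dual g) g) y

include hC hD hf in
-- Grothendieck duality. Since `fDown` preserves compacts, `fUp₁` preserves coproducts, and the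
-- comparison need only be checked on rigid objects.
lemma nonempty_iso_comp_tensorLeft {fDown : C ⥤ D} (adj₀ : f ⊣ fDown) {fUp₁ : D ⥤ C}
    (adj' : fDown ⊣ fUp₁) (hfDown : ∀ z : C, IsCompactObj z → IsCompactObj (fDown.obj z)) :
    Nonempty (f ⋙ tensorLeft (fUp₁.obj (𝟙_ D)) ≅ fUp₁) := by
  let := adj₀.rightAdjointCommShift ℤ
  have := adj₀.commShift_of_leftAdjoint ℤ
  have := adj₀.isTriangulated_rightAdjoint
  have := adj'.right_adjoint_additive
  have h (x y) := isIso_projection hC hD hf adj₀ x y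
  let τ : f ⋙ tensorLeft (fUp₁.obj (𝟙_ D)) ⟶ fUp₁ :=
    { app := fun y => tensorComparison adj₀ adj' y
      naturality := fun y y' a => tensorComparison_naturality adj₀ adj' a }
  have (y : D) : IsIso (τ.app y) := hD.1.isIso_app_of_mapsDistinguished hC.1
    ((mapsDistinguished_of_isTriangulated f).comp (mapsDistinguished_tensorLeft _))
    (MapsDistinguished.rightAdjoint adj')
    (fun J => have := hf J; inferInstance)
    (preservesCoproducts_of_preserves_compact hD.1 hC.1 adj' hfDown) τ
    (fun g hg => letI := ((hD.2 g).1 hg).exactPairing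
      isIso_tensorComparison_of_exactPairing adj₀ adj' (dual g) g) y
  have := NatIso.isIso_of_isIso_app τ
  exact ⟨asIso τ⟩

end

/-! ### Iterated duals, powers of an equivalence, and isomorphisms detected on compact objects. -/

section Curry

variable {C : Type u} [Category.{v} C] [MonoidalCategory C] [MonoidalClosed C]

/-- The dual of the unit is the unit. -/
noncomputable def unitDualIso : dual (𝟙_ C) ≅ 𝟙_ C := (MonoidalClosed.unitNatIso.app (𝟙_ C)).symm

/-- The comparison of the iterated internal hom with the dual of a tensor product. -/
noncomputable def ihomDualHom (w z : C) : (ihom w).obj (dual z) ⟶ dual (z ⊗ w) :=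
  MonoidalClosed.curry ((α_ _ _ _).hom ≫
    MonoidalClosed.uncurry (MonoidalClosed.uncurry (𝟙 ((ihom w).obj (dual z)))))

lemma comp_ihomDualHom {w z t : C} (a : t ⟶ (ihom w).obj (dual z)) :
    a ≫ ihomDualHom w z = MonoidalClosed.curry ((α_ _ _ _).hom ≫
      MonoidalClosed.uncurry (MonoidalClosed.uncurry a)) := by
  rw [ihomDualHom, ← MonoidalClosed.curry_natural_left, associator_naturality_right_assoc,
    ← MonoidalClosed.uncurry_natural_left, ← MonoidalClosed.uncurry_natural_left,
    Category.comp_id]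

instance (w z : C) : IsIso (ihomDualHom w z) := by
  refine isIso_of_yoneda_map_bijective _ fun t => ?_
  let e₁ : (t ⟶ (ihom w).obj (dual z)) ≃ (w ⊗ t ⟶ dual z) :=
    ((ihom.adjunction w).homEquiv _ _).symm
  let e₂ : (w ⊗ t ⟶ dual z) ≃ (z ⊗ w ⊗ t ⟶ 𝟙_ C) := ((ihom.adjunction z).homEquiv _ _).symm
  let e₃ : (z ⊗ w ⊗ t ⟶ 𝟙_ C) ≃ ((z ⊗ w) ⊗ t ⟶ 𝟙_ C) := (α_ z w t).symm.homFromEquiv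
  let e₄ : ((z ⊗ w) ⊗ t ⟶ 𝟙_ C) ≃ (t ⟶ dual (z ⊗ w)) := (ihom.adjunction (z ⊗ w)).homEquiv _ _
  convert (e₁.trans (e₂.trans (e₃.trans e₄))).bijective using 1
  ext a
  exact comp_ihomDualHom a

lemma ihomDualHom_naturality (w : C) {z z' : C} (c : z ⟶ z') :
    (ihom w).map (dualMap c) ≫ ihomDualHom w z = ihomDualHom w z' ≫ dualMap (c ▷ w) := by
  rw [comp_ihomDualHom, ihomDualHom, MonoidalClosed.curry_pre_app]
  congr 1
  rw [associator_naturality_left_assoc, ← MonoidalClosed.uncurry_pre_app,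
    ← MonoidalClosed.uncurry_natural_right, Category.id_comp]

end Curry

lemma exists_zpow {C : Type u} [Category.{v} C] (T : C ≌ C) :
    ∃ E : ℤ → (C ≌ C), E 0 = .refl ∧
      ∀ n, Nonempty (T.functor ⋙ (E n).functor ≅ (E (n + 1)).functor) := by
  let P : ℕ → (C ≌ C) := fun n => Nat.rec .refl (fun _ e => e.trans T) n
  -- `.negSucc n` is `-(n + 1)`, hence the index `n + 1` of the inverted power.
  refine ⟨fun | .ofNat n => P n | .negSucc n => (P (n + 1)).symm, rfl, ?_⟩
  rintro (n | n)
  · change Nonempty (T.functor ⋙ (P n).functor ≅ (P (n + 1)).functor)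
    induction n with
    | zero => exact ⟨Iso.refl _⟩
    | succ n ih =>
      obtain ⟨e⟩ := ih
      exact ⟨Functor.isoWhiskerRight e T.functor⟩
  · have e : T.functor ⋙ (P (n + 1)).inverse ≅ (P n).inverse :=
      Functor.isoWhiskerRight T.unitIso.symm (P n).inverse
    cases n with
    | zero => exact ⟨e⟩
    | succ n => exact ⟨e⟩

/-- The equivalence given by tensoring with an invertible object. -/
def tensorLeftEquivalence {C : Type u} [Category.{v} C] [MonoidalCategory C] {x y : C}
    (e : y ⊗ x ≅ 𝟙_ C) (e' : x ⊗ y ≅ 𝟙_ C) : C ≌ C :=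
  .mk (tensorLeft x) (tensorLeft y)
    ((leftUnitorNatIso C).symm ≪≫ (curriedTensor C).mapIso e.symm ≪≫ tensorLeftTensor y x)
    ((tensorLeftTensor x y).symm ≪≫ (curriedTensor C).mapIso e' ≪≫ leftUnitorNatIso C)

/-- By Yoneda `φ` is composition with `φ x (𝟙 x)`. Naturality must hold on all objects, bijectivity
only on compact ones. -/
lemma IsCompactlyGenerated.nonempty_iso {C : Type u} [Category.{v} C] [HasZeroObject C]
    [Preadditive C] [HasShift C ℤ] [∀ n : ℤ, (shiftFunctor C n).Additive] [Pretriangulated C]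
    (hC : IsCompactlyGenerated C) {x y : C} (φ : ∀ z, (z ⟶ x) → (z ⟶ y))
    (hφ : ∀ ⦃z z' : C⦄ (c : z ⟶ z') (a : z' ⟶ x), φ z (c ≫ a) = c ≫ φ z' a)
    (h : ∀ g, IsCompactObj g → Function.Bijective (φ g)) : Nonempty (x ≅ y) := by
  have : IsIso (φ x (𝟙 x)) := hC.isIso _ fun g hg => by
    convert h g hg using 1
    ext a
    rw [← hφ, Category.comp_id]
  exact ⟨asIso (φ x (𝟙 x))⟩

/-! ### The infinite tower, and mutual exclusion of the three cases. -/

section Tower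

variable {C : Type u₁} [Category.{v} C] {D : Type u₂} [Category.{v} D] {f : D ⥤ C}

/-- Put `f^(n) = T^n f` and `f_(n) = f_* T^n`. The right adjoint of `f_* T^(-n)` is `T^n f^(1) ≅ T^n
T f = f^(n+1)`. -/
lemma infiniteTower_of_equivalence {fDown : C ⥤ D} (adj₀ : f ⊣ fDown) {fUp₁ : D ⥤ C}
    (adj' : fDown ⊣ fUp₁) (T : C ≌ C) (e : f ⋙ T.functor ≅ fUp₁) : InfiniteTower f := by
  obtain ⟨E, h₀, h⟩ := exists_zpow T
  refine ⟨fun n => f ⋙ (E n).functor, fun n => (E (-n)).inverse ⋙ fDown, ?_, fun n => ?_⟩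
  · dsimp only
    rw [h₀]
    rfl
  · dsimp only
    rw [neg_neg]
    obtain ⟨i⟩ := h n
    exact ⟨⟨adj₀.comp (E n).toAdjunction⟩, ⟨((E n).symm.toAdjunction.comp adj').ofNatIsoRight
      (Functor.isoWhiskerRight e.symm (E n).functor ≪≫ Functor.isoWhiskerLeft f i)⟩⟩

lemma ExactlyThree.not_exactlyFive (h : ExactlyThree f) : ¬ ExactlyFive f := by
  obtain ⟨_, _, _, _, h, _⟩ := h
  rintro ⟨_, _, _, _, ⟨adj⟩, _⟩
  exact h adj.isRightAdjoint

lemma ExactlyThree.not_infiniteTower (h : ExactlyThree f) : ¬ InfiniteTower f := by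
  obtain ⟨_, _, _, _, h, _⟩ := h
  rintro ⟨fUp, fDown, rfl, ht⟩
  -- At `n = -1` the second adjunction has right adjoint `fUp 0`, which is the given functor.
  obtain ⟨-, ⟨adj⟩⟩ := ht (-1)
  exact h adj.isRightAdjoint

lemma ExactlyFive.not_infiniteTower (h : ExactlyFive f) : ¬ InfiniteTower f := by
  obtain ⟨fDown₁, _, _, _, ⟨adj₁⟩, _, _, _, h, _⟩ := h
  rintro ⟨fUp, fDown, rfl, ht⟩
  obtain ⟨⟨adj⟩, ⟨adj'⟩⟩ := ht (-1)
  -- `fDown 1` and `fDown₁` are both left adjoint to `fUp 0`, so `fUp (-1)` is left adjoint to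
  -- `fDown₁` as well.
  exact h (adj.ofNatIsoRight (adj'.leftAdjointUniq adj₁)).isRightAdjoint

end Tower

/-! ### Relative duality and rigidity of the relative dualizing object. -/

section Wirthmuller

variable {C : Type u₁} [Category.{v} C] [MonoidalCategory C] [SymmetricCategory C]
  [MonoidalClosed C]
  {D : Type u₂} [Category.{v} D] [MonoidalCategory D] [SymmetricCategory D] [MonoidalClosed D]
  {f : D ⥤ C} [f.Braided] {fDown₁ fDown : C ⥤ D} (adj₁ : fDown₁ ⊣ f) (adj₀ : f ⊣ fDown)
  {fUp₁ : D ⥤ C} (adj' : fDown ⊣ fUp₁)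
  [∀ w, IsIso (dualLeftAdjointHom adj₁ adj₀ w)]

/-- Given `fDown₁ ⊣ f ⊣ fDown ⊣ fUp₁`, the comparison between morphisms
`𝟙_ D ⟶ fDown₁ (dual z)` and `z ⟶ fUp₁ (𝟙_ D)`. -/
noncomputable def relativeDualityMap (z : C) (a : 𝟙_ D ⟶ fDown₁.obj (dual z)) :
    z ⟶ fUp₁.obj (𝟙_ D) :=
  adj'.homEquiv _ _ (fDown.map (bidual z) ≫ inv (dualLeftAdjointHom adj₁ adj₀ (dual z)) ≫
    dualMap a ≫ unitDualIso.hom)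

lemma relativeDualityMap_naturality {z z' : C} (c : z ⟶ z')
    (a : 𝟙_ D ⟶ fDown₁.obj (dual z')) :
    relativeDualityMap adj₁ adj₀ adj' z (a ≫ fDown₁.map (dualMap c)) =
      c ≫ relativeDualityMap adj₁ adj₀ adj' z' a := by
  have h : fDown.map (dualMap (dualMap c)) ≫ inv (dualLeftAdjointHom adj₁ adj₀ (dual z')) =
      inv (dualLeftAdjointHom adj₁ adj₀ (dual z)) ≫ dualMap (fDown₁.map (dualMap c)) := by
    rw [IsIso.comp_inv_eq, Category.assoc, IsIso.eq_inv_comp, dualLeftAdjointHom_naturality]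
  rw [relativeDualityMap, relativeDualityMap, ← adj'.homEquiv_naturality_left, dualMap_comp,
    ← fDown.map_comp_assoc, bidual_naturality, fDown.map_comp_assoc, reassoc_of% h,
    Category.assoc]

/-- Dualizing is bijective on maps into the rigid object `fDown₁ (dual z)`, whose dual is `fDown z`;
the rest is `Hom(fDown z, 𝟙) = Hom(z, fUp₁ 𝟙)`. -/
lemma bijective_relativeDualityMap {z : C} (hz : IsRigidObj z)
    (hz' : IsRigidObj (fDown₁.obj (dual z))) :
    Function.Bijective (relativeDualityMap adj₁ adj₀ adj' z) := by
  have := hz.isIso_bidual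
  let e₁ : (dual (fDown₁.obj (dual z)) ⟶ dual (𝟙_ D)) ≃
      (fDown.obj z ⟶ dual (𝟙_ D)) :=
    (asIso (fDown.map (bidual z) ≫ inv (dualLeftAdjointHom adj₁ adj₀ (dual z)))).symm.homFromEquiv
  let e₂ : (fDown.obj z ⟶ dual (𝟙_ D)) ≃ (fDown.obj z ⟶ 𝟙_ D) := unitDualIso.homToEquiv
  convert (e₁.trans (e₂.trans (adj'.homEquiv _ _))).bijective.comp
    (hz'.bijective_dualMap (𝟙_ D)) using 1
  ext a
  change adj'.homEquiv _ _ _ = adj'.homEquiv _ _ (((fDown.map (bidual z) ≫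
    inv (dualLeftAdjointHom adj₁ adj₀ (dual z))) ≫ dualMap a) ≫ unitDualIso.hom)
  simp only [Category.assoc]

end Wirthmuller

section

variable {C : Type u₁} [Category.{v} C] [Preadditive C] [MonoidalCategory C] [MonoidalClosed C]
  {D : Type u₂} [Category.{v} D] [Preadditive D] [MonoidalCategory D] [MonoidalClosed D]
  (hC : IsRigidlyCompactlyGenerated C) (hD : IsRigidlyCompactlyGenerated D)
  {f : D ⥤ C} [f.Additive]

include hC hD in
lemma isRigidObj_obj_dual [SymmetricCategory C]
    (hf : ∀ J : Type v, PreservesColimitsOfShape (Discrete J) f) {fDown₁ : C ⥤ D}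
    (adj₁ : fDown₁ ⊣ f) {z : C} (hz : IsRigidObj z) : IsRigidObj (fDown₁.obj (dual z)) := by
  have := adj₁.left_adjoint_additive
  have := hD.1.1
  exact (hD.2 _).1 (IsCompactObj.of_adjunction adj₁ hf ((hC.2 _).2 hz.dual))

include hC hD in
/-- If the rightmost functor has a right adjoint then the relative dualizing object is rigid. -/
lemma isRigidObj_of_isLeftAdjoint {fDown fDownNeg₁ : C ⥤ D} (adj₀ : f ⊣ fDown) {fUp₁ : D ⥤ C}
    (adj' : fDown ⊣ fUp₁) (adj'' : fUp₁ ⊣ fDownNeg₁) (h : fDownNeg₁.IsLeftAdjoint) :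
    IsRigidObj (fUp₁.obj (𝟙_ D)) := by
  obtain ⟨R, ⟨adj⟩⟩ := h
  have := adj₀.right_adjoint_additive
  have := adj'.right_adjoint_additive
  have := hC.1.1
  exact (hC.2 _).1 (IsCompactObj.of_adjunction adj''
    (fun J => have := adj.leftAdjoint_preservesColimits; inferInstance)
    ((hD.2 _).2 isRigidObj_unit))

end

section

variable {C : Type u₁} [Category.{v} C] [HasZeroObject C] [Preadditive C] [HasShift C ℤ]
  [∀ n : ℤ, (shiftFunctor C n).Additive] [Pretriangulated C]
  [MonoidalCategory C] [SymmetricCategory C] [MonoidalClosed C]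
  {D : Type u₂} [Category.{v} D] [HasZeroObject D] [Preadditive D] [HasShift D ℤ]
  [∀ n : ℤ, (shiftFunctor D n).Additive] [Pretriangulated D]
  [MonoidalCategory D] [SymmetricCategory D] [MonoidalClosed D]
  (hC : IsRigidlyCompactlyGenerated C) (hD : IsRigidlyCompactlyGenerated D)
  {f : D ⥤ C} [f.Braided] [f.Additive]
  (hf : ∀ J : Type v, PreservesColimitsOfShape (Discrete J) f)
  {fDown₁ fDown : C ⥤ D} (adj₁ : fDown₁ ⊣ f) (adj₀ : f ⊣ fDown)
  {fUp₁ : D ⥤ C} (adj' : fDown ⊣ fUp₁)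

include hC hD hf adj₁ adj₀ adj' in
/-- If the leftmost functor has a left adjoint then the relative dualizing object is rigid. -/
lemma isRigidObj_of_isRightAdjoint (h : fDown₁.IsRightAdjoint) :
    IsRigidObj (fUp₁.obj (𝟙_ D)) := by
  obtain ⟨L, ⟨adj⟩⟩ := h
  have := adj₁.left_adjoint_additive
  have := adj.left_adjoint_additive
  have := hC.1.1
  have (w : C) := isIso_dualLeftAdjointHom hD adj₁ adj₀ w
  have hL : IsCompactObj (L.obj (𝟙_ D)) := IsCompactObj.of_adjunction adj
    (fun J => have := adj₁.leftAdjoint_preservesColimits; inferInstance)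
    ((hD.2 _).2 isRigidObj_unit)
  have hK := ((hC.2 _).1 hL).dual
  -- Followed by `relativeDualityMap`, this compares maps into `dual (L 𝟙)` with maps into `fUp₁ 𝟙`,
  -- so the latter object is the dual of a rigid one.
  let e (z : C) : (z ⟶ dual (L.obj (𝟙_ D))) ≃ (𝟙_ D ⟶ fDown₁.obj (dual z)) :=
    (dualSwap z (L.obj (𝟙_ D))).trans (adj.homEquiv _ _)
  obtain ⟨i⟩ := hC.1.nonempty_iso (x := dual (L.obj (𝟙_ D))) (y := fUp₁.obj (𝟙_ D))
    (fun z a => relativeDualityMap adj₁ adj₀ adj' z (e z a))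
    (fun z z' c a => by
      rw [← relativeDualityMap_naturality]
      congr 1
      change adj.homEquiv _ _ (dualSwap _ _ _) = adj.homEquiv _ _ (dualSwap _ _ _) ≫ _
      rw [← adj.homEquiv_naturality_right, dualSwap_comp])
    (fun g hg => (bijective_relativeDualityMap adj₁ adj₀ adj' ((hC.2 _).1 hg)
      (isRigidObj_obj_dual hC hD hf adj₁ ((hC.2 _).1 hg))).comp (e g).bijective)
  exact (hC.2 _).1 (((hC.2 _).2 hK).of_iso i)

include hC hD hf adj₁ adj₀ adj' in
-- For `z` compact, `Hom(z, 𝟙) = Hom(𝟙, dual z) = Hom(𝟙, fDown (dual z)) = Hom(𝟙, fDown₁ (dual (z ⊗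
-- ω))) = Hom(z ⊗ ω, ω) = Hom(z, hom(ω, ω))`.
lemma nonempty_unit_iso (hω : IsRigidObj (fUp₁.obj (𝟙_ D)))
    (e : f ⋙ tensorLeft (fUp₁.obj (𝟙_ D)) ≅ fUp₁) :
    Nonempty (𝟙_ C ≅ (ihom (fUp₁.obj (𝟙_ D))).obj (fUp₁.obj (𝟙_ D))) := by
  have (w : C) := isIso_dualLeftAdjointHom hD adj₁ adj₀ w
  set ω : C := fUp₁.obj (𝟙_ D) with hω_def
  let p₁ := hω.exactPairing
  let p₂ := BraidedCategory.exactPairing_swap (dual ω) ω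
  -- For rigid `ω`, `hom(ω, -) ≅ dual ω ⊗ -` is also left adjoint to `ω ⊗ -`.
  let adjω : ihom ω ⊣ tensorLeft ω := (tensorLeftAdjunction ω (dual ω)).ofNatIsoLeft
    ((tensorLeftAdjunction (dual ω) ω).rightAdjointUniq (ihom.adjunction ω))
  -- The Wirthmüller isomorphism: both functors are left adjoint to `fUp₁ ≅ ω ⊗ f`.
  let θ : fDown ≅ ihom ω ⋙ fDown₁ :=
    adj'.leftAdjointUniq ((adjω.comp adj₁).ofNatIsoRight e)
  let e₁ (z : C) : (z ⟶ 𝟙_ C) ≃ (𝟙_ C ⟶ dual z) :=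
    (unitDualIso.symm.homToEquiv).trans (dualSwap z (𝟙_ C))
  let e₂ (z : C) : (𝟙_ C ⟶ dual z) ≃ (𝟙_ D ⟶ fDown.obj (dual z)) :=
    ((Functor.Monoidal.εIso f).homFromEquiv).trans (adj₀.homEquiv _ _)
  let e₃ (z : C) : (𝟙_ D ⟶ fDown.obj (dual z)) ≃ (𝟙_ D ⟶ fDown₁.obj (dual (z ⊗ ω))) :=
    (θ.app (dual z) ≪≫ fDown₁.mapIso (asIso (ihomDualHom ω z))).homToEquiv
  let e₄ (z : C) : (z ⊗ ω ⟶ ω) ≃ (z ⟶ (ihom ω).obj ω) :=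
    (β_ z ω).homFromEquiv.trans ((ihom.adjunction ω).homEquiv z ω)
  refine hC.1.nonempty_iso (fun z a => e₄ z (relativeDualityMap adj₁ adj₀ adj' (z ⊗ ω)
    (e₃ z (e₂ z (e₁ z a))))) (fun z z' c a => ?_) fun g hg => ?_
  · have h₁ : e₁ z (c ≫ a) = e₁ z' a ≫ dualMap c := by
      change dualSwap _ _ ((c ≫ a) ≫ _) = dualSwap _ _ (a ≫ _) ≫ _
      rw [Category.assoc, dualSwap_comp]
    have h₂ (b : 𝟙_ C ⟶ dual z') : e₂ z (b ≫ dualMap c) = e₂ z' b ≫ fDown.map (dualMap c) := by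
      change adj₀.homEquiv _ _ (_ ≫ b ≫ _) = adj₀.homEquiv _ _ (_ ≫ b) ≫ _
      rw [← adj₀.homEquiv_naturality_right, Category.assoc]
    have h₃ (b : 𝟙_ D ⟶ fDown.obj (dual z')) : e₃ z (b ≫ fDown.map (dualMap c)) =
        e₃ z' b ≫ fDown₁.map (dualMap (c ▷ ω)) := by
      change (b ≫ fDown.map (dualMap c)) ≫ θ.hom.app (dual z) ≫ fDown₁.map (ihomDualHom ω z) =
        (b ≫ θ.hom.app (dual z') ≫ fDown₁.map (ihomDualHom ω z')) ≫ _
      have h := θ.hom.naturality (dualMap c)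
      rw [Category.assoc, reassoc_of% h, Category.assoc, Category.assoc, ← fDown₁.map_comp,
        ← fDown₁.map_comp, ← ihomDualHom_naturality]
    have h₄ (b : z' ⊗ ω ⟶ ω) : e₄ z (c ▷ ω ≫ b) = c ≫ e₄ z' b := by
      change MonoidalClosed.curry (_ ≫ c ▷ ω ≫ b) = c ≫ MonoidalClosed.curry (_ ≫ b)
      rw [← MonoidalClosed.curry_natural_left]
      congr 1
      rw [BraidedCategory.braiding_inv_naturality_right_assoc]
    rw [h₁, h₂, h₃, relativeDualityMap_naturality, h₄]
  · have hg' := ((hC.2 _).1 hg).tensor hω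
    exact (e₄ g).bijective.comp ((bijective_relativeDualityMap adj₁ adj₀ adj' hg'
      (isRigidObj_obj_dual hC hD hf adj₁ hg')).comp
        ((e₁ g).trans ((e₂ g).trans (e₃ g))).bijective)

end

/-! ### The trichotomy. -/

section

variable {C : Type u₁} [Category.{v} C] [HasZeroObject C] [Preadditive C] [HasShift C ℤ]
  [∀ n : ℤ, (shiftFunctor C n).Additive] [Pretriangulated C]
  [MonoidalCategory C] [SymmetricCategory C] [MonoidalClosed C]
  {D : Type u₂} [Category.{v} D] [HasZeroObject D] [Preadditive D] [HasShift D ℤ]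
  [∀ n : ℤ, (shiftFunctor D n).Additive] [Pretriangulated D]
  [MonoidalCategory D] [SymmetricCategory D] [MonoidalClosed D]
  (hC : IsRigidlyCompactlyGenerated C) (hD : IsRigidlyCompactlyGenerated D)
  {f : D ⥤ C} [f.Braided] [f.CommShift ℤ] [f.IsTriangulated]
  (hf : ∀ J : Type v, PreservesColimitsOfShape (Discrete J) f)

include hC hD hf in
-- Each side implies that `fDown` preserves compact objects, and this in turn implies the other
-- side.
lemma isRightAdjoint_iff_isLeftAdjoint {fDown : C ⥤ D} (adj₀ : f ⊣ fDown) {fUp₁ : D ⥤ C}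
    (adj' : fDown ⊣ fUp₁) : f.IsRightAdjoint ↔ fUp₁.IsLeftAdjoint := by
  constructor
  · rintro ⟨_, ⟨adj₁⟩⟩
    exact hC.1.isLeftAdjoint_rightAdjoint_rightAdjoint hD.1 adj₀ adj'
      fun z hz => isCompactObj_of_leftAdjoint hC hD adj₁ adj₀ hf hz
  · rintro ⟨_, ⟨adj''⟩⟩
    have := adj₀.right_adjoint_additive
    have := hD.1.1
    exact IsCompactlyGenerated.isRightAdjoint f hC.1 fun z hz =>
      leftAdjointObjIsDefined_of_isCompactObj hC hD hf adj₀
        (fun _ => IsCompactObj.of_adjunction adj'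
          (fun J => have := adj''.leftAdjoint_preservesColimits; inferInstance)) hz

variable [TensorTriangulated C] [TensorTriangulated D]

include hC hD hf in
lemma infiniteTower_of_isRigidObj {fDown₁ fDown : C ⥤ D} (adj₁ : fDown₁ ⊣ f) (adj₀ : f ⊣ fDown)
    {fUp₁ : D ⥤ C} (adj' : fDown ⊣ fUp₁) (hω : IsRigidObj (fUp₁.obj (𝟙_ D))) :
    InfiniteTower f := by
  obtain ⟨e⟩ := nonempty_iso_comp_tensorLeft hC hD hf adj₀ adj'
    fun z hz => isCompactObj_of_leftAdjoint hC hD adj₁ adj₀ hf hz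
  obtain ⟨i⟩ := nonempty_unit_iso hC hD hf adj₁ adj₀ adj' hω e
  have := hω (fUp₁.obj (𝟙_ D))
  -- Rigidity turns `hom(ω, ω) ≅ 𝟙` into `dual ω ⊗ ω ≅ 𝟙`, so `ω` is invertible.
  let i' := asIso (dualTensorHom (fUp₁.obj (𝟙_ D)) (fUp₁.obj (𝟙_ D))) ≪≫ i.symm
  exact infiniteTower_of_equivalence adj₀ adj'
    (tensorLeftEquivalence i' (β_ (fUp₁.obj (𝟙_ D)) (dual (fUp₁.obj (𝟙_ D))) ≪≫ i')) e

include hC hD hf in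
theorem exactlyThree_or_exactlyFive_or_infiniteTower :
    ExactlyThree f ∨ ExactlyFive f ∨ InfiniteTower f := by
  obtain ⟨fDown, ⟨adj₀⟩⟩ := hD.1.isLeftAdjoint f hf
  obtain ⟨fUp₁, ⟨adj'⟩⟩ := hC.1.isLeftAdjoint_rightAdjoint hD.1 adj₀
    fun t ht => hC.isCompactObj_map hD f ht
  have h := isRightAdjoint_iff_isLeftAdjoint hC hD hf adj₀ adj'
  by_cases h₁ : f.IsRightAdjoint
  · obtain ⟨fDownNeg₁, ⟨adj''⟩⟩ := h.1 h₁
    obtain ⟨fDown₁, ⟨adj₁⟩⟩ := h₁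
    by_cases h₂ : fDown₁.IsRightAdjoint
    · exact .inr (.inr (infiniteTower_of_isRigidObj hC hD hf adj₁ adj₀ adj'
        (isRigidObj_of_isRightAdjoint hC hD hf adj₁ adj₀ adj' h₂)))
    by_cases h₃ : fDownNeg₁.IsLeftAdjoint
    · exact .inr (.inr (infiniteTower_of_isRigidObj hC hD hf adj₁ adj₀ adj'
        (isRigidObj_of_isLeftAdjoint hC hD adj₀ adj' adj'' h₃)))
    exact .inr (.inl ⟨_, _, _, _, ⟨adj₁⟩, ⟨adj₀⟩, ⟨adj'⟩, ⟨adj''⟩, h₂, h₃⟩)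
  · exact .inl ⟨_, _, ⟨adj₀⟩, ⟨adj'⟩, h₁, mt h.2 h₁⟩

end

end TTAdjoints
theorem mainTheorem3
    {C : Type u₁} [Category.{v} C] [HasZeroObject C] [Preadditive C] [HasShift C ℤ]
    [∀ n : ℤ, (shiftFunctor C n).Additive] [Pretriangulated C] [IsTriangulated C]
    [MonoidalCategory C] [SymmetricCategory C] [MonoidalClosed C]
    [TTAdjoints.TensorTriangulated C]
    {D : Type u₂} [Category.{v} D] [HasZeroObject D] [Preadditive D] [HasShift D ℤ]
    [∀ n : ℤ, (shiftFunctor D n).Additive] [Pretriangulated D] [IsTriangulated D]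
    [MonoidalCategory D] [SymmetricCategory D] [MonoidalClosed D]
    [TTAdjoints.TensorTriangulated D]
    (hC : TTAdjoints.IsRigidlyCompactlyGenerated C)
    (hD : TTAdjoints.IsRigidlyCompactlyGenerated D)
    (f : D ⥤ C) [f.Braided] [f.CommShift ℤ] [f.IsTriangulated]
    (hf : ∀ J : Type v, PreservesColimitsOfShape (Discrete J) f) :
    (TTAdjoints.ExactlyThree f ∨ TTAdjoints.ExactlyFive f ∨ TTAdjoints.InfiniteTower f) ∧
      ¬ (TTAdjoints.ExactlyThree f ∧ TTAdjoints.ExactlyFive f) ∧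
      ¬ (TTAdjoints.ExactlyThree f ∧ TTAdjoints.InfiniteTower f) ∧
      ¬ (TTAdjoints.ExactlyFive f ∧ TTAdjoints.InfiniteTower f) := by
  exact ⟨TTAdjoints.exactlyThree_or_exactlyFive_or_infiniteTower hC hD hf,
    fun h => h.1.not_exactlyFive h.2, fun h => h.1.not_infiniteTower h.2,
    fun h => h.1.not_infiniteTower h.2⟩
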